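/- Let $d\ge 1$ and let $r,q$ satisfy $$\frac2r+\frac dq\le 1,\qquad\text{with } \begin{cases} r\in[2,\infty),\ q\in(d,\infty] & \text{if } d\ge 2,\\ r\in[2,4],\ q\in[2,\infty] & \text{if } d=1.\end{cases}$$ For every $M\ge 0$ there is a constant $C=C(d,r,q,M)$ with the following property. Let $b:[0,1]\times\mathbb R^d\to\mathbb R^d$ be a measurable vector field with $\|b\|_{L^r([0,1];L^q(\mathbb R^d))}\le M$, and let $u$ be a solution of the advection-diffusion equation $$\partial_t u+\operatorname{div}(bu)=\Delta u\qquad\text{on }[0,1]\times\mathbb R^d$$ in the parabolic class $u\in L^2([0,1];H^1(\mathbb R^d))$, $u'\in L^2([0,1];H^{-1}(\mathbb R^d))$, where $u'$ is the distributional time derivative of $u$; that is, for every $v\in H^1(\mathbb R^d)$ and almost every $t\in[0,1]$, $$\langle u'(t),v\rangle+\int_{\mathbb R^d}\nabla u(t)\cdot\nabla v\,dx=\int_{\mathbb R^d}u(t)\,b(t)\cdot\nabla v\,dx .$$ Then $u$ coincides for almost every $t$ with a function in $C([0,1];L^2(\mathbb R^d))$ and, for this representative and the initial datum $u_0=u(0,\cdot)$,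 $$\|u(t,\cdot)\|_{L^2(\mathbb R^d)}\le C\,\|u_0\|_{L^2(\mathbb R^d)}\qquad\text{for all } 0\le t\le 1 .$$ -/

import Mathlib

open MeasureTheory Set Filter Topology
open scoped ENNReal NNReal ContDiff

noncomputable section

namespace AdvectionDiffusion

/-- `ℝ^d` with its Euclidean norm. -/
abbrev Space (d : ℕ) : Type := EuclideanSpace ℝ (Fin d)

/-- `L²(ℝ^d)`, real valued. -/
abbrev L2 (d : ℕ) : Type := Lp ℝ 2 (volume : Measure (Space d))

/-- `L²(ℝ^d; ℝ^d)`. -/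
abbrev L2Vec (d : ℕ) : Type := Lp (Space d) 2 (volume : Measure (Space d))

/-- `g` is the weak (distributional) gradient of `f` on `ℝ^d`:
`∫ f ∂_e φ = - ∫ φ (g · e)` for all test functions `φ ∈ C_c^∞(ℝ^d)` and all directions `e`. -/
def IsWeakGradient {d : ℕ} (f : L2 d) (g : L2Vec d) : Prop :=
  ∀ φ : Space d → ℝ, ContDiff ℝ ∞ φ → HasCompactSupport φ → ∀ e : Space d,
    ∫ x, f x * fderiv ℝ φ x e = -∫ x, φ x * inner ℝ (g x) e

lemma integrable_mul_fderiv {d : ℕ} (f : L2 d) {φ : Space d → ℝ} (hφ : ContDiff ℝ ∞ φ)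
    (hc : HasCompactSupport φ) (e : Space d) :
    Integrable (fun x => f x * fderiv ℝ φ x e) := by
  have hcont : Continuous (fun x => fderiv ℝ φ x e) :=
    (hφ.continuous_fderiv (by simp)).clm_apply continuous_const
  have hsupp : HasCompactSupport (fun x => fderiv ℝ φ x e) := hc.fderiv_apply (𝕜 := ℝ) e
  exact MemLp.integrable_mul (p := 2) (q := 2) (Lp.memLp f) (hcont.memLp_of_hasCompactSupport hsupp)

lemma integrable_mul_inner {d : ℕ} (g : L2Vec d) {φ : Space d → ℝ} (hφ : ContDiff ℝ ∞ φ)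
    (hc : HasCompactSupport φ) (e : Space d) :
    Integrable (fun x => φ x * inner ℝ (g x) e) :=
  MemLp.integrable_mul (p := 2) (q := 2) (hφ.continuous.memLp_of_hasCompactSupport hc)
    ((Lp.memLp g).inner_const e)

/-- The Sobolev space `H¹(ℝ^d)`: the pairs `(f, ∇f)` where `f ∈ L²` has the weak gradient
`∇f ∈ L²`, with the Hilbert norm `(‖f‖₂² + ‖∇f‖₂²)^{1/2}` inherited from `L² × L²`. (The weak
gradient is determined by `f`, so that such a pair is the same thing as a function in `H¹`.) -/
def H1 (d : ℕ) : Submodule ℝ (WithLp 2 (L2 d × L2Vec d)) where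
  carrier := {p | IsWeakGradient p.fst p.snd}
  zero_mem' := by
    intro φ _ _ e
    simp
  add_mem' := by
    intro p q hp hq φ hφ hc e
    have h1 : ∫ x, (p.fst + q.fst) x * fderiv ℝ φ x e
        = (∫ x, p.fst x * fderiv ℝ φ x e) + ∫ x, q.fst x * fderiv ℝ φ x e := by
      rw [← integral_add (integrable_mul_fderiv _ hφ hc e) (integrable_mul_fderiv _ hφ hc e)]
      apply integral_congr_ae
      filter_upwards [Lp.coeFn_add p.fst q.fst] with x hx
      rw [hx, Pi.add_apply, add_mul]
    have h2 : ∫ x, φ x * inner ℝ ((p.snd + q.snd) x) e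
        = (∫ x, φ x * inner ℝ (p.snd x) e) + ∫ x, φ x * inner ℝ (q.snd x) e := by
      rw [← integral_add (integrable_mul_inner _ hφ hc e) (integrable_mul_inner _ hφ hc e)]
      apply integral_congr_ae
      filter_upwards [Lp.coeFn_add p.snd q.snd] with x hx
      rw [hx, Pi.add_apply, inner_add_left, mul_add]
    change ∫ x, (p.fst + q.fst) x * fderiv ℝ φ x e
      = -∫ x, φ x * inner ℝ ((p.snd + q.snd) x) e
    rw [h1, h2, hp φ hφ hc e, hq φ hφ hc e]
    ring
  smul_mem' := by
    intro c p hp φ hφ hc e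
    have h1 : ∫ x, (c • p.fst) x * fderiv ℝ φ x e = c * ∫ x, p.fst x * fderiv ℝ φ x e := by
      rw [← integral_const_mul]
      apply integral_congr_ae
      filter_upwards [Lp.coeFn_smul c p.fst] with x hx
      rw [hx, Pi.smul_apply, smul_eq_mul, mul_assoc]
    have h2 : ∫ x, φ x * inner ℝ ((c • p.snd) x) e = c * ∫ x, φ x * inner ℝ (p.snd x) e := by
      rw [← integral_const_mul]
      apply integral_congr_ae
      filter_upwards [Lp.coeFn_smul c p.snd] with x hx
      rw [hx, Pi.smul_apply, real_inner_smul_left]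
      ring
    change ∫ x, (c • p.fst) x * fderiv ℝ φ x e = -∫ x, φ x * inner ℝ ((c • p.snd) x) e
    rw [h1, h2, hp φ hφ hc e]
    ring

/-- The underlying `L²` function of an element of `H¹`. -/
def H1.toL2 {d : ℕ} (v : H1 d) : L2 d := v.1.fst

/-- The weak gradient of an element of `H¹`. -/
def H1.grad {d : ℕ} (v : H1 d) : L2Vec d := v.1.snd

/-- `H⁻¹(ℝ^d)`, the dual of `H¹(ℝ^d)` with the dual norm. -/
abbrev Hneg1 (d : ℕ) : Type := StrongDual ℝ (H1 d)

/-- Lebesgue measure on the time interval `[0,1]`. -/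
def timeMeasure : Measure ℝ := volume.restrict (Icc 0 1)

/-- The norm of `b` in `L^r([0,1]; L^q(ℝ^d; ℝ^d))`, with values in `[0,∞]`. -/
def mixedNorm {d : ℕ} (r q : ℝ≥0∞) (b : ℝ → Space d → Space d) : ℝ≥0∞ :=
  eLpNorm (fun t => eLpNorm (b t) q volume) r timeMeasure

/-- The range of exponents: `2/r + d/q ≤ 1`, with `r ∈ [2,∞)`, `q ∈ (d,∞]` if `d ≥ 2`, and
`r ∈ [2,4]`, `q ∈ [2,∞]` if `d = 1`. -/
def AdmissibleExponents (d : ℕ) (r q : ℝ≥0∞) : Prop :=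
  2 / r + (d : ℝ≥0∞) / q ≤ 1 ∧
    ((2 ≤ d ∧ 2 ≤ r ∧ r < ⊤ ∧ (d : ℝ≥0∞) < q) ∨ (d = 1 ∧ 2 ≤ r ∧ r ≤ 4 ∧ 2 ≤ q))

/-- `w : [0,1] → H⁻¹` is the distributional time derivative `u'` on `(0,1)` of `u : [0,1] → H¹`,
where `L²` (and so `H¹`) is embedded in `H⁻¹` by the `L²` inner product:
`∫ ψ'(t) u(t) dt = - ∫ ψ(t) w(t) dt` in `H⁻¹` for all `ψ ∈ C_c^∞(0,1)`. -/
def IsWeakTimeDeriv {d : ℕ} (u : ℝ → H1 d) (w : ℝ → Hneg1 d) : Prop :=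
  ∀ ψ : ℝ → ℝ, ContDiff ℝ ∞ ψ → HasCompactSupport ψ → tsupport ψ ⊆ Ioo 0 1 →
    ∀ v : H1 d,
      ∫ t, deriv ψ t * inner ℝ (H1.toL2 (u t)) (H1.toL2 v) ∂timeMeasure = -∫ t, ψ t * w t v ∂timeMeasure

/-- `u` is a weak solution of `∂_t u + div (b u) = Δ u` on `[0,1] × ℝ^d` in the parabolic class
`u ∈ L²([0,1]; H¹)`, `u' ∈ L²([0,1]; H⁻¹)`: for every `v ∈ H¹` and almost every `t`,
`⟨u'(t), v⟩ + ∫ ∇u(t) · ∇v dx = ∫ u(t) b(t) · ∇v dx`. -/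
def IsParabolicSolution {d : ℕ} (b : ℝ → Space d → Space d) (u : ℝ → H1 d) : Prop :=
  MemLp u 2 timeMeasure ∧
  ∃ w : ℝ → Hneg1 d, MemLp w 2 timeMeasure ∧ IsWeakTimeDeriv u w ∧
    ∀ v : H1 d, ∀ᵐ t ∂timeMeasure,
      w t v + ∫ x, inner ℝ (H1.grad (u t) x) (H1.grad v x)
        = ∫ x, H1.toL2 (u t) x * inner ℝ (b t x) (H1.grad v x)

end AdvectionDiffusion

end

noncomputable section

namespace AdvectionDiffusion

/-! Testing the equation at time `t` with `u(t)` itself gives `½ d/dt ‖u‖² + ‖∇u‖² = ∫ u b · ∇u`,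
and the right side is at most `‖u b‖₂ ‖∇u‖₂`. With `θ = d/q`, Hölder and Gagliardo–Nirenberg give
`‖u b‖₂ ≤ C ‖b‖_q ‖u‖₂^(1-θ) ‖∇u‖₂^θ`. Since `2/r > 0`, `θ < 1`, and Young's inequality absorbs the
gradient at the price of a multiple of `‖b‖_q^(2/(1-θ)) ‖u‖₂²`. The condition `2/r + d/q ≤ 1` says
exactly that `2/(1-θ) ≤ r`, so this coefficient is at most `1 + ‖b‖_q^r`, whose time integral is at
most `1 + M^r`. Grönwall's inequality concludes.

Three points need care. The derivative of `‖u‖²` and the continuous representative come from the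
Lions–Magenes lemma (`exists_continuous_representative`), proved for any bounded `j : V → H` with
`V` separable and `H` complete. Its energy identity uses no mollification: time increments of `‖j
u‖²` are averaged over `[a,b]`, rewritten by Fubini as integrals of a translated pairing, and
differentiated at Lebesgue points. The identity then makes `j u` Cauchy at every time.

The product bound (`exists_eLpNorm_smul_le`) needs Gagliardo–Nirenberg at only one exponent `Q ≤ q`,
because interpolation between `Q` and `∞` reaches `q`. It is shown for test functions (Agmon for `d
= 1`, powers of `h` in `W^{1,1} ⊂ L²` for `d = 2`, Sobolev for `d ≥ 3`) and passed to `H¹` by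
mollification, cutoff and Fatou.

The equation holds for each `v` off a null set depending on `v`. Separability of `H¹` and `u b ∈ L²`
allow the choice `v = u(t)` at almost every time (`energy_inequality_at_time`). -/

lemma integral_timeMeasure_eq_intervalIntegral {E : Type*} [NormedAddCommGroup E] [NormedSpace ℝ E]
    (f : ℝ → E) : ∫ t, f t ∂timeMeasure = ∫ t in (0 : ℝ)..1, f t := by
  rw [intervalIntegral.integral_of_le zero_le_one, ← integral_Icc_eq_integral_Ioc, timeMeasure]

lemma intervalIntegrable_of_integrable_timeMeasure {E : Type*} [NormedAddCommGroup E]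
    {f : ℝ → E} (hf : Integrable f timeMeasure) : IntervalIntegrable f volume 0 1 := by
  rw [intervalIntegrable_iff_integrableOn_Icc_of_le zero_le_one]
  exact hf

instance : IsProbabilityMeasure timeMeasure :=
  ⟨by simp [timeMeasure]⟩

lemma integrable_continuous_mul {φ k : ℝ → ℝ} (hφ : Continuous φ) (hk : Integrable k timeMeasure) :
    Integrable (fun t => φ t * k t) timeMeasure :=
  (show IntegrableOn k (Icc 0 1) volume from hk).continuousOn_mul hφ.continuousOn isCompact_Icc

/-! ### Weak derivatives on the unit time interval -/

/-- A smooth function supported in `(0,1)` with vanishing integral has a primitive that is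
a test function on `(0,1)`. -/
lemma exists_primitive_test_function {η : ℝ → ℝ} (hη : ContDiff ℝ ∞ η) (hc : HasCompactSupport η)
    (hs : tsupport η ⊆ Ioo 0 1) (h0 : ∫ t, η t = 0) :
    ∃ ψ : ℝ → ℝ, ContDiff ℝ ∞ ψ ∧ HasCompactSupport ψ ∧ tsupport ψ ⊆ Ioo 0 1 ∧ deriv ψ = η := by
  have hcont : Continuous η := hη.continuous
  -- If `η = 0`, the choice `a = 1`, `b = 0` makes the interval empty.
  obtain ⟨a, b, ha, hb, hab⟩ : ∃ a b : ℝ, 0 < a ∧ b < 1 ∧ ∀ t, η t ≠ 0 → t ∈ Icc a b := by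
    rcases (tsupport η).eq_empty_or_nonempty with he | hne
    · refine ⟨1, 0, one_pos, one_pos, fun t ht => ?_⟩
      have : t ∈ tsupport η := subset_tsupport _ ht
      simp [he] at this
    · obtain ⟨a, ha⟩ := hc.isCompact.exists_isLeast hne
      obtain ⟨b, hb⟩ := hc.isCompact.exists_isGreatest hne
      exact ⟨a, b, (hs ha.1).1, (hs hb.1).2, fun t ht =>
        ⟨ha.2 (subset_tsupport _ ht), hb.2 (subset_tsupport _ ht)⟩⟩
  have hd : ∀ t, HasDerivAt (fun t => ∫ s in (0 : ℝ)..t, η s) (η t) t := fun t =>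
    intervalIntegral.integral_hasDerivAt_right (hcont.intervalIntegrable _ _)
      (hcont.stronglyMeasurableAtFilter _ _) hcont.continuousAt
  have hderiv : deriv (fun t => ∫ s in (0 : ℝ)..t, η s) = η := funext fun t => (hd t).deriv
  have hz : ∀ t, t ∉ Icc a b → ∫ s in (0 : ℝ)..t, η s = 0 := by
    intro t ht
    have hη0 : ∀ s, s ∉ Icc a b → η s = 0 := fun s hs => by
      by_contra h
      exact hs (hab s h)
    rcases lt_or_ge t a with hta | hta
    · apply intervalIntegral.integral_zero_ae
      refine Eventually.of_forall fun s hs => hη0 s fun h => ?_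
      have := hs.2
      have h1 := h.1
      rcases le_max_iff.1 this with h2 | h2 <;> linarith
    -- To the right of the support the primitive is the full integral of `η`, which vanishes.
    · have htb : b < t := by
        by_contra h
        exact ht ⟨hta, not_lt.1 h⟩
      have hz0 : ∫ s in Iic (0 : ℝ), η s = 0 :=
        setIntegral_eq_zero_of_forall_eq_zero fun s hs => hη0 s fun h => by
          have := h.1
          have : s ≤ 0 := hs
          linarith
      have hz1 : ∫ s in Ioi t, η s = 0 :=
        setIntegral_eq_zero_of_forall_eq_zero fun s hs => hη0 s fun h => by
          have := h.2
          have : t < s := hs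
          linarith
      have hint : Integrable η := hcont.integrable_of_hasCompactSupport hc
      have h1 := intervalIntegral.integral_Iic_sub_Iic (a := 0) (b := t)
        hint.integrableOn hint.integrableOn
      have h2 := integral_add_compl (measurableSet_Iic (a := t)) hint
      rw [compl_Iic, hz1, h0, add_zero] at h2
      rw [← h1, h2, hz0, sub_zero]
  have hsupp : tsupport (fun t => ∫ s in (0 : ℝ)..t, η s) ⊆ Icc a b := by
    apply closure_minimal _ isClosed_Icc
    intro t ht
    by_contra h
    exact ht (hz t h)
  refine ⟨fun t => ∫ s in (0 : ℝ)..t, η s, ?_, ?_, ?_, hderiv⟩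
  · rw [contDiff_infty_iff_deriv]
    exact ⟨fun t => (hd t).differentiableAt, by rwa [hderiv]⟩
  · exact isCompact_Icc.of_isClosed_subset (isClosed_tsupport _) hsupp
  · exact hsupp.trans fun t ht => ⟨ha.trans_le ht.1, ht.2.trans_lt hb⟩

/-- A function whose weak derivative on `(0,1)` vanishes is almost everywhere constant. -/
lemma ae_eq_const_of_weakDeriv_eq_zero {h : ℝ → ℝ} (hh : Integrable h timeMeasure)
    (hw : ∀ ψ : ℝ → ℝ, ContDiff ℝ ∞ ψ → HasCompactSupport ψ → tsupport ψ ⊆ Ioo 0 1 →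
      ∫ t, deriv ψ t * h t ∂timeMeasure = 0) :
    ∃ c : ℝ, ∀ᵐ t ∂timeMeasure, h t = c := by
  -- For a fixed `ρ` of mass one, `η - (∫ η) ρ` has mean zero, hence is the derivative of a test
  -- function; so `∫ η h = (∫ η)(∫ ρ h)`, and the constant must be `∫ ρ h`.
  let φ : ContDiffBump (1 / 2 : ℝ) := ⟨1 / 8, 1 / 4, by norm_num, by norm_num⟩
  let ρ : ℝ → ℝ := φ.normed volume
  have hρ : ContDiff ℝ ∞ ρ := φ.contDiff_normed
  have hρc : HasCompactSupport ρ := φ.hasCompactSupport_normed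
  have hρs : tsupport ρ ⊆ Ioo 0 1 := by
    rw [φ.tsupport_normed_eq, Real.closedBall_eq_Icc]
    intro x hx
    simp only [mem_Icc, φ] at hx
    constructor <;> linarith [hx.1, hx.2]
  have hρ1 : ∫ t, ρ t = 1 := φ.integral_normed
  have hmul : ∀ η : ℝ → ℝ, Continuous η → Integrable (fun t => η t * h t) timeMeasure :=
    fun η hη => integrable_continuous_mul hη hh
  set c := ∫ t, ρ t * h t ∂timeMeasure with hcdef
  refine ⟨c, ?_⟩
  have hint : IntegrableOn (fun t => h t - c) (Icc 0 1) :=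
    hh.sub (integrable_const c)
  have key := (isOpen_Ioo (a := (0 : ℝ)) (b := 1)).ae_eq_zero_of_integral_contDiff_smul_eq_zero
    (f := fun t => h t - c) (μ := volume)
    ((hint.mono_set Ioo_subset_Icc_self).locallyIntegrableOn) (by
    intro η hη hηc hηs
    set m := ∫ t, η t with hm
    have hηi : Integrable η := hη.continuous.integrable_of_hasCompactSupport hηc
    have hρi : Integrable ρ := hρ.continuous.integrable_of_hasCompactSupport hρc
    obtain ⟨ψ, h1, h2, h3, h4⟩ := exists_primitive_test_function (η := fun t => η t - m * ρ t)
      (hη.sub (contDiff_const.mul hρ)) (hηc.sub (hρc.mul_left (f := fun _ => m)))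
      (by
        refine (tsupport_sub (f := η) (g := fun t => m * ρ t)).trans (union_subset hηs ?_)
        exact (tsupport_mul_subset_right (f := fun _ => m) (g := ρ)).trans hρs)
      (by rw [integral_sub hηi (hρi.const_mul m), integral_const_mul, hρ1, mul_one, sub_self])
    have h5 := hw ψ h1 h2 h3
    simp only [h4, sub_mul, mul_assoc] at h5
    rw [integral_sub (hmul η hη.continuous) ((hmul ρ hρ.continuous).const_mul m),
      integral_const_mul, ← hcdef] at h5
    have h6 : ∫ t, η t ∂timeMeasure = m := by
      rw [timeMeasure, setIntegral_eq_integral_of_forall_compl_eq_zero]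
      intro t ht
      by_contra h
      exact ht (Ioo_subset_Icc_self (hηs (subset_tsupport _ h)))
    calc ∫ t, η t • (h t - c) = ∫ t, η t * (h t - c) ∂timeMeasure := by
          rw [timeMeasure, setIntegral_eq_integral_of_forall_compl_eq_zero]
          · rfl
          · intro t ht
            have : η t = 0 := by
              by_contra h
              exact ht (Ioo_subset_Icc_self (hηs (subset_tsupport _ h)))
            simp [this]
      _ = 0 := by
          simp only [mul_sub]
          rw [integral_sub (hmul η hη.continuous), integral_mul_const, h6]
          · linarith
          · exact (hηi.mul_const c).mono_measure Measure.restrict_le_self)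
  rw [timeMeasure, restrict_Ioo_eq_restrict_Icc.symm, ae_restrict_iff' measurableSet_Ioo]
  filter_upwards [key] with t ht hmem
  linarith [ht hmem]

/-- A function with integrable weak derivative on `(0,1)` is almost everywhere a primitive of it. -/
lemma ae_eq_primitive_of_weakDeriv {f g : ℝ → ℝ} (hf : Integrable f timeMeasure)
    (hg : Integrable g timeMeasure)
    (hw : ∀ ψ : ℝ → ℝ, ContDiff ℝ ∞ ψ → HasCompactSupport ψ → tsupport ψ ⊆ Ioo 0 1 →
      ∫ t, deriv ψ t * f t ∂timeMeasure = -∫ t, ψ t * g t ∂timeMeasure) :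
    ∃ c : ℝ, ∀ᵐ t ∂timeMeasure, f t = c + ∫ s in (0 : ℝ)..t, g s := by
  have hgi := intervalIntegrable_of_integrable_timeMeasure hg
  have hac := hgi.absolutelyContinuousOnInterval_intervalIntegral (c := 0) (by simp)
  have hGc : ContinuousOn (fun t => ∫ s in (0 : ℝ)..t, g s) (Icc 0 1) := by
    simpa using hac.continuousOn
  have hGi : Integrable (fun t => ∫ s in (0 : ℝ)..t, g s) timeMeasure :=
    hGc.integrableOn_compact isCompact_Icc
  obtain ⟨c, hc⟩ := ae_eq_const_of_weakDeriv_eq_zero (h := fun t => f t - ∫ s in (0 : ℝ)..t, g s)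
    (hf.sub hGi) (by
    intro ψ h1 h2 h3
    have hψd : Continuous (deriv ψ) := h1.continuous_deriv (by simp)
    have hmul : ∀ k : ℝ → ℝ, Integrable k timeMeasure →
        Integrable (fun t => deriv ψ t * k t) timeMeasure :=
      fun k hk => integrable_continuous_mul hψd hk
    simp only [mul_sub]
    rw [integral_sub (hmul _ hf) (hmul _ hGi), hw ψ h1 h2 h3]
    have hψac : AbsolutelyContinuousOnInterval ψ 0 1 :=
      (h1.of_le (by simp)).contDiffOn.absolutelyContinuousOnInterval
    have hibp := hψac.integral_mul_deriv_eq_deriv_mul hac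
    have hψ0 : ψ 0 = 0 := by
      by_contra h
      exact lt_irrefl _ (h3 (subset_tsupport _ h)).1
    have hψ1 : ψ 1 = 0 := by
      by_contra h
      exact lt_irrefl _ (h3 (subset_tsupport _ h)).2
    rw [hψ0, hψ1, zero_mul, zero_mul, sub_zero, zero_sub] at hibp
    rw [integral_timeMeasure_eq_intervalIntegral, integral_timeMeasure_eq_intervalIntegral]
    have hcongr : ∫ t in (0 : ℝ)..1, ψ t * deriv (fun t => ∫ s in (0 : ℝ)..t, g s) t
        = ∫ t in (0 : ℝ)..1, ψ t * g t := by
      apply intervalIntegral.integral_congr_ae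
      filter_upwards [hgi.ae_hasDerivAt_integral] with t ht hmem
      rw [(ht (uIoc_subset_uIcc hmem) 0 (by simp)).deriv]
    rw [hcongr] at hibp
    rw [hibp]
    ring)
  refine ⟨c, ?_⟩
  filter_upwards [hc] with t ht
  linarith

/-! ### Duality pairings under time translation -/

section Duality
variable {V : Type*} [NormedAddCommGroup V] [NormedSpace ℝ V]

lemma aestronglyMeasurable_dual_apply {α : Type*} [MeasurableSpace α] {μ : Measure α}
    {w : α → StrongDual ℝ V} {u : α → V} (hw : AEStronglyMeasurable w μ)
    (hu : AEStronglyMeasurable u μ) : AEStronglyMeasurable (fun x => w x (u x)) μ :=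
  (isBoundedBilinearMap_apply (𝕜 := ℝ) (E := V) (F := ℝ)).continuous.comp_aestronglyMeasurable
    (hw.prodMk hu)

lemma integrable_dual_apply {α : Type*} [MeasurableSpace α] {μ : Measure α}
    {w : α → StrongDual ℝ V} {u : α → V} (hw : MemLp w 2 μ) (hu : MemLp u 2 μ) :
    Integrable (fun x => w x (u x)) μ := by
  refine (MemLp.integrable_mul (p := 2) (q := 2) hw.norm hu.norm).mono'
    (aestronglyMeasurable_dual_apply hw.1 hu.1) (Eventually.of_forall fun x => ?_)
  exact (w x).le_opNorm (u x)

lemma memLp_translate {E : Type*} [NormedAddCommGroup E] {f : ℝ → E} (hf : MemLp f 2 volume)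
    (a : ℝ) : MemLp (fun t => f (a + t)) 2 volume :=
  hf.comp_measurePreserving (measurePreserving_add_left volume a)

lemma continuous_translate_Lp {E : Type*} [NormedAddCommGroup E] {f : ℝ → E}
    (hf : MemLp f 2 volume) : Continuous (fun a : ℝ => (memLp_translate hf a).toLp) := by
  let g : C(ℝ, C(ℝ, ℝ)) := (ContinuousMap.mk (fun p : ℝ × ℝ => p.1 + p.2)).curry
  have h := Continuous.compMeasurePreservingLp (p := 2) (μ := volume) (ν := volume) (E := E)
    (f := fun _ : ℝ => hf.toLp f) (g := g) continuous_const g.continuous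
    (fun a => measurePreserving_add_left volume a) (by simp)
  exact h

/-- Translation is continuous in `L²`, and restriction and pairing are bounded. The two shifts are
independent because the energy identity compares the pairs `(σ, h)` and `(σ, 0)`. -/
lemma continuous_pairing_translate {w : ℝ → StrongDual ℝ V} {u : ℝ → V} (hw : MemLp w 2 volume)
    (hu : MemLp u 2 volume) (s : Set ℝ) :
    Continuous (fun p : ℝ × ℝ => ∫ t in s, w (p.1 + t) (u (p.2 + t))) := by
  let B : StrongDual ℝ V →L[ℝ] V →L[ℝ] ℝ := ContinuousLinearMap.id ℝ _
  have h : Continuous (fun p : ℝ × ℝ => B.lpPairing (volume.restrict s) 2 2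
      (LpToLpRestrictCLM ℝ _ ℝ volume 2 s (memLp_translate hw p.1).toLp)
      (LpToLpRestrictCLM ℝ _ ℝ volume 2 s (memLp_translate hu p.2).toLp)) := by
    refine (((B.lpPairing (volume.restrict s) 2 2).continuous.comp
      ((LpToLpRestrictCLM ℝ _ ℝ volume 2 s).continuous.comp
        ((continuous_translate_Lp hw).comp continuous_fst))).clm_apply
      ((LpToLpRestrictCLM ℝ _ ℝ volume 2 s).continuous.comp
        ((continuous_translate_Lp hu).comp continuous_snd)))
  convert h using 2 with p
  rw [ContinuousLinearMap.lpPairing_eq_integral]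
  apply integral_congr_ae
  filter_upwards [LpToLpRestrictCLM_coeFn ℝ s (memLp_translate hw p.1).toLp,
    LpToLpRestrictCLM_coeFn ℝ s (memLp_translate hu p.2).toLp,
    ae_restrict_of_ae (memLp_translate hw p.1).coeFn_toLp,
    ae_restrict_of_ae (memLp_translate hu p.2).coeFn_toLp] with t h1 h2 h3 h4
  rw [h1, h2, h3, h4]
  rfl

/-- Fubini applies because `(σ, t) ↦ (σ, σ + t)` preserves measure and `r` has finite measure, so
both factors are in `L²` of the product. -/
lemma integral_swap_translate {w : ℝ → StrongDual ℝ V} {u : ℝ → V} (hw : MemLp w 2 volume)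
    (hu : MemLp u 2 volume) (s r : Set ℝ) [IsFiniteMeasure (volume.restrict r)] (β : ℝ) :
    ∫ t in s, ∫ σ in r, w (σ + t) (u (β + t)) = ∫ σ in r, ∫ t in s, w (σ + t) (u (β + t)) := by
  symm
  apply integral_integral_swap
  have hprod : (volume.restrict r).prod (volume.restrict s)
      ≤ (volume.restrict r).prod (volume : Measure ℝ) := by
    conv_rhs => rw [← Measure.restrict_univ (μ := volume.restrict r)]
    conv_lhs => rw [← Measure.restrict_univ (μ := volume.restrict r)]
    rw [Measure.prod_restrict]
    refine Measure.restrict_le_self.trans ?_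
    rw [Measure.restrict_univ]
  refine Integrable.mono_measure ?_ hprod
  refine integrable_dual_apply (w := fun p : ℝ × ℝ => w (p.1 + p.2))
    (u := fun p : ℝ × ℝ => u (β + p.2)) ?_ ?_
  · exact (hw.comp_snd (volume.restrict r)).comp_measurePreserving
      (measurePreserving_prod_add (volume.restrict r) volume)
  · exact (memLp_translate hu β).comp_snd (volume.restrict r)

end Duality

lemma intervalIntegrable_of_mem_Icc {E : Type*} [NormedAddCommGroup E] {f : ℝ → E}
    (hf : Integrable f timeMeasure) {a b : ℝ} (ha : a ∈ Icc (0 : ℝ) 1) (hb : b ∈ Icc (0 : ℝ) 1) :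
    IntervalIntegrable f volume a b := by
  refine (intervalIntegrable_of_integrable_timeMeasure hf).mono_set ?_
  rw [uIcc_of_le zero_le_one]
  exact ordConnected_Icc.uIcc_subset ha hb

/-! ### Lions–Magenes: the energy identity -/

section Lions
variable {V H : Type*} [NormedAddCommGroup V] [NormedSpace ℝ V] [NormedAddCommGroup H]
  [InnerProductSpace ℝ H]

/-- Off a null set of times, the increments of `u` are the integrals of its weak derivative. -/
lemma exists_times_inner_sub_eq [SecondCountableTopology V] (j : V →L[ℝ] H) {u : ℝ → V}
    {w : ℝ → StrongDual ℝ V} (hu : MemLp u 2 timeMeasure) (hw : MemLp w 2 timeMeasure)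
    (huw : ∀ ψ : ℝ → ℝ, ContDiff ℝ ∞ ψ → HasCompactSupport ψ → tsupport ψ ⊆ Ioo 0 1 → ∀ v : V,
      ∫ t, deriv ψ t * inner ℝ (j (u t)) (j v) ∂timeMeasure = -∫ t, ψ t * w t v ∂timeMeasure) :
    ∃ T : Set ℝ, (∀ᵐ t ∂timeMeasure, t ∈ T) ∧ T ⊆ Icc 0 1 ∧ ∀ s ∈ T, ∀ t ∈ T, ∀ v : V,
      inner ℝ (j (u t) - j (u s)) (j v) = (∫ x in s..t, w x) v := by
  have hui : Integrable u timeMeasure := hu.integrable one_le_two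
  have hwi : Integrable w timeMeasure := hw.integrable one_le_two
  have hprim : ∀ v : V, ∃ c : ℝ, ∀ᵐ t ∂timeMeasure,
      inner ℝ (j (u t)) (j v) = c + ∫ s in (0 : ℝ)..t, w s v := fun v =>
    ae_eq_primitive_of_weakDeriv ((j.integrable_comp hui).inner_const (j v))
      (hwi.apply_continuousLinearMap v) fun ψ h1 h2 h3 => huw ψ h1 h2 h3 v
  choose c hc using hprim
  -- The exceptional null set depends on `v`; a dense sequence gives a single one, and continuity in
  -- `v` recovers all of `V`.
  have hae : ∀ᵐ t ∂timeMeasure, ∀ n : ℕ, inner ℝ (j (u t)) (j (TopologicalSpace.denseSeq V n))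
      = c (TopologicalSpace.denseSeq V n)
        + ∫ s in (0 : ℝ)..t, w s (TopologicalSpace.denseSeq V n) :=
    ae_all_iff.2 fun n => hc (TopologicalSpace.denseSeq V n)
  refine ⟨{t | t ∈ Icc (0 : ℝ) 1 ∧ ∀ n : ℕ, inner ℝ (j (u t)) (j (TopologicalSpace.denseSeq V n))
      = c (TopologicalSpace.denseSeq V n)
        + ∫ s in (0 : ℝ)..t, w s (TopologicalSpace.denseSeq V n)}, ?_, fun t ht => ht.1, ?_⟩
  · filter_upwards [hae, ae_restrict_mem measurableSet_Icc] with t h1 h2 using ⟨h2, h1⟩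
  · intro s hs t ht v
    have h0 : (0 : ℝ) ∈ Icc (0 : ℝ) 1 := by simp
    refine congrFun ((TopologicalSpace.denseRange_denseSeq V).equalizer
      (g := fun v => inner ℝ (j (u t) - j (u s)) (j v))
      (h := fun v => (∫ x in s..t, w x) v) (by fun_prop) (by fun_prop) (funext fun n => ?_)) v
    simp only [Function.comp_apply]
    rw [inner_sub_left, hs.2 n, ht.2 n,
      ContinuousLinearMap.intervalIntegral_apply (intervalIntegrable_of_mem_Icc hwi hs.1 ht.1),
      ← intervalIntegral.integral_interval_sub_left
        (intervalIntegrable_of_mem_Icc (hwi.apply_continuousLinearMap _) h0 ht.1)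
        (intervalIntegrable_of_mem_Icc (hwi.apply_continuousLinearMap _) h0 hs.1)]
    ring

/-- The energy identity off a null set of times. -/
lemma exists_times_energy_identity (j : V →L[ℝ] H) {u : ℝ → V} {w : ℝ → StrongDual ℝ V}
    (hu : MemLp u 2 volume) (hw : MemLp w 2 volume) {T : Set ℝ}
    (hT : ∀ᵐ t ∂timeMeasure, t ∈ T)
    (huw : ∀ s ∈ T, ∀ t ∈ T, ∀ v : V, inner ℝ (j (u t) - j (u s)) (j v) = (∫ x in s..t, w x) v) :
    ∃ T' ⊆ T, (∀ᵐ t ∂timeMeasure, t ∈ T') ∧ ∀ s ∈ T', ∀ t ∈ T',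
      ‖j (u t)‖ ^ 2 - ‖j (u s)‖ ^ 2 = 2 * ∫ x in s..t, w x (u x) := by
  set f : ℝ → ℝ := fun t => ‖j (u t)‖ ^ 2 with hf
  have hju : MemLp (fun t => j (u t)) 2 volume := j.comp_memLp' hu
  have hfi : Integrable f := hju.integrable_norm_pow (by norm_num)
  have hwl : LocallyIntegrable w := hw.locallyIntegrable one_le_two
  have hwii : ∀ a b, IntervalIntegrable w volume a b := fun a b =>
    (hwl.integrableOn_isCompact isCompact_uIcc).intervalIntegrable
  have hTv : ∀ᵐ t : ℝ, t ∈ Icc (0 : ℝ) 1 → t ∈ T := by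
    rwa [timeMeasure, ae_restrict_iff' measurableSet_Icc] at hT
  refine ⟨T ∩ {t | t ∈ Ioo (0 : ℝ) 1 ∧ ∀ c, HasDerivAt (fun x => ∫ t in c..x, f t) (f t) t},
    inter_subset_left, ?_, ?_⟩
  · have h01 : ∀ᵐ t ∂timeMeasure, t ∈ Ioo (0 : ℝ) 1 := by
      rw [timeMeasure, restrict_Ioo_eq_restrict_Icc.symm]
      exact ae_restrict_mem measurableSet_Ioo
    filter_upwards [hT, h01,
      ae_restrict_of_ae (LocallyIntegrable.ae_hasDerivAt_integral hfi.locallyIntegrable)]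
      with t h1 h2 h3 using ⟨h1, h2, h3⟩
  suffices hmain : ∀ a b : ℝ, a ∈ Ioo (0 : ℝ) 1 → b ∈ Ioo (0 : ℝ) 1 → a ≤ b →
      HasDerivAt (fun x => ∫ t in (0 : ℝ)..x, f t) (f a) a →
      HasDerivAt (fun x => ∫ t in (0 : ℝ)..x, f t) (f b) b →
      f b - f a = 2 * ∫ x in a..b, w x (u x) by
    intro s hs t ht
    rcases le_total s t with hst | hts
    · exact hmain s t hs.2.1 ht.2.1 hst (hs.2.2 0) (ht.2.2 0)
    · have := hmain t s ht.2.1 hs.2.1 hts (ht.2.2 0) (hs.2.2 0)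
      rw [intervalIntegral.integral_symm]
      linarith
  intro a b ha hb hab hda hdb
  set P : ℝ → ℝ := fun x => ∫ t in (0 : ℝ)..x, f t with hP
  set G : ℝ × ℝ → ℝ := fun p => ∫ t in Ioc a b, w (p.1 + t) (u (p.2 + t)) with hG
  have hGc : Continuous G := continuous_pairing_translate hw hu (Ioc a b)
  have hG0 : G (0, 0) = ∫ x in a..b, w x (u x) := by
    simp only [hG, zero_add]
    rw [intervalIntegral.integral_of_le hab]
  -- `D h` is the integral of `f (h + t) - f t` over `[a,b]`. Its right derivative at `0` is
  -- computed twice: as `f b - f a`, since `a` and `b` are Lebesgue points, and as `2 G (0, 0)`.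
  set D : ℝ → ℝ := fun h => (P (b + h) - P b) - (P (a + h) - P a) with hD
  have hDform : ∀ h, 0 < h → h < 1 - b → D h = ∫ σ in Ioc 0 h, (G (σ, h) + G (σ, 0)) := by
    intro h h0 h1
    have hfii : ∀ a b, IntervalIntegrable f volume a b := fun a b => hfi.intervalIntegrable
    have e1 : D h = ∫ t in Ioc a b, (f (h + t) - f t) := by
      have e2 : ∫ t in a..b, f (h + t) = P (b + h) - P (a + h) := by
        rw [intervalIntegral.integral_comp_add_left, add_comm h a, add_comm h b, hP,
          intervalIntegral.integral_interval_sub_left (hfii _ _) (hfii _ _)]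
      have e3 : ∫ t in a..b, f t = P b - P a := by
        rw [hP, intervalIntegral.integral_interval_sub_left (hfii _ _) (hfii _ _)]
      rw [← intervalIntegral.integral_of_le hab, intervalIntegral.integral_sub
        (hfi.comp_add_left h).intervalIntegrable (hfii _ _), e2, e3]
      simp only [hD]
      ring
    have hTh : ∀ᵐ t : ℝ, h + t ∈ Icc (0 : ℝ) 1 → h + t ∈ T :=
      (measurePreserving_add_left volume h).quasiMeasurePreserving.ae hTv
    have e4 : ∫ t in Ioc a b, (f (h + t) - f t)
        = ∫ t in Ioc a b, ((∫ σ in Ioc 0 h, w (σ + t) (u (h + t)))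
          + ∫ σ in Ioc 0 h, w (σ + t) (u (0 + t))) := by
      apply setIntegral_congr_ae measurableSet_Ioc
      filter_upwards [hTv, hTh] with t ht1 ht2 htm
      have m1 : t ∈ T := ht1 ⟨by linarith [htm.1, ha.1], by linarith [htm.2, hb.2]⟩
      have m2 : h + t ∈ T := ht2 ⟨by linarith [htm.1, ha.1], by linarith [htm.2, hb.2]⟩
      -- Pairing the increment with the sum of the two values produces the difference of the squared
      -- norms.
      have e5 := huw t m1 (h + t) m2 (u (h + t) + u t)
      have e6 : ∀ v, (∫ x in t..h + t, w x) v = ∫ σ in Ioc 0 h, w (σ + t) v := by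
        intro v
        rw [ContinuousLinearMap.intervalIntegral_apply (hwii _ _),
          ← intervalIntegral.integral_of_le h0.le,
          intervalIntegral.integral_comp_add_right (fun x => w x v), zero_add]
      rw [zero_add, ← e6, ← e6, ← map_add, ← e5, map_add, inner_sub_left, inner_add_right,
        inner_add_right, real_inner_self_eq_norm_sq, real_inner_self_eq_norm_sq,
        real_inner_comm (j (u t)) (j (u (h + t)))]
      simp only [hf]
      ring
    have hint : ∀ β, Integrable (fun t => ∫ σ in Ioc 0 h, w (σ + t) (u (β + t)))
        (volume.restrict (Ioc a b)) := by
      intro β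
      have hp : ((volume : Measure ℝ).restrict (Ioc a b)).prod (volume.restrict (Ioc 0 h))
          ≤ (volume : Measure ℝ).prod ((volume : Measure ℝ).restrict (Ioc 0 h)) := by
        conv_rhs => rw [← Measure.restrict_univ (μ := (volume : Measure ℝ).restrict (Ioc 0 h))]
        conv_lhs => rw [← Measure.restrict_univ (μ := (volume : Measure ℝ).restrict (Ioc 0 h))]
        rw [Measure.prod_restrict]
        refine Measure.restrict_le_self.trans ?_
        rw [Measure.restrict_univ]
      have hI := integrable_dual_apply (μ := (volume.restrict (Ioc 0 h)).prod volume)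
        (w := fun p : ℝ × ℝ => w (p.1 + p.2))
        (u := fun p : ℝ × ℝ => u (β + p.2))
        ((hw.comp_snd (volume.restrict (Ioc 0 h))).comp_measurePreserving
          (measurePreserving_prod_add (volume.restrict (Ioc 0 h)) volume))
        ((memLp_translate hu β).comp_snd (volume.restrict (Ioc 0 h)))
      exact (hI.swap.mono_measure hp).integral_prod_left
    rw [e1, e4, integral_add (hint h) (hint 0), integral_swap_translate hw hu,
      integral_swap_translate hw hu, ← integral_add]
    · exact ((hGc.comp (continuous_id.prodMk continuous_const)).integrableOn_Icc).mono_set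
        Ioc_subset_Icc_self
    · exact ((hGc.comp (continuous_id.prodMk continuous_const)).integrableOn_Icc).mono_set
        Ioc_subset_Icc_self
  have hDd : HasDerivAt D (f b - f a) 0 := by
    have h1 : HasDerivAt (fun h => P (b + h)) (f b) 0 :=
      HasDerivAt.comp_const_add (f := P) b 0 (by simpa using hdb)
    have h2 : HasDerivAt (fun h => P (a + h)) (f a) 0 :=
      HasDerivAt.comp_const_add (f := P) a 0 (by simpa using hda)
    exact (h1.sub_const (P b)).sub (h2.sub_const (P a))
  have hlim1 := hDd.tendsto_slope_zero_right
  have hD0 : D 0 = 0 := by simp [hD]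
  simp only [zero_add, hD0, sub_zero, smul_eq_mul] at hlim1
  -- An average of a continuous function over the shrinking interval `(0, h]` tends to its value at
  -- the origin.
  have hlim2 : Tendsto (fun h => h⁻¹ * D h) (𝓝[>] 0) (𝓝 (2 * G (0, 0))) := by
    rw [Metric.tendsto_nhds]
    intro ε hε
    obtain ⟨δ, hδ, hball⟩ := Metric.continuousAt_iff.1 (hGc.continuousAt (x := (0, 0))) (ε / 4)
      (by positivity)
    have hmin : 0 < min δ (1 - b) := lt_min hδ (by linarith [hb.2])
    filter_upwards [Ioo_mem_nhdsGT hmin] with h hh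
    have hh0 : 0 < h := hh.1
    have hhδ : h < δ := hh.2.trans_le (min_le_left _ _)
    rw [hDform h hh0 (hh.2.trans_le (min_le_right _ _))]
    have hi : IntegrableOn (fun σ => G (σ, h) + G (σ, 0)) (Ioc 0 h) := by
      refine (Continuous.integrableOn_Icc ?_).mono_set Ioc_subset_Icc_self
      exact (hGc.comp (continuous_id.prodMk continuous_const)).add
        (hGc.comp (continuous_id.prodMk continuous_const))
    have hb1 : ‖∫ σ in Ioc 0 h, (G (σ, h) + G (σ, 0) - 2 * G (0, 0))‖ ≤ ε / 2 * h := by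
      have := norm_setIntegral_le_of_norm_le_const (μ := volume) (s := Ioc 0 h)
        (f := fun σ => G (σ, h) + G (σ, 0) - 2 * G (0, 0)) (C := ε / 2) (by simp)
        (fun σ hσ => by
          have d1 : dist (G (σ, h)) (G (0, 0)) < ε / 4 := hball (by
            rw [Prod.dist_eq, max_lt_iff, Real.dist_eq, Real.dist_eq]
            simp only [sub_zero]
            rw [abs_of_pos hσ.1, abs_of_pos hh0]
            exact ⟨hσ.2.trans_lt hhδ, hhδ⟩)
          have d2 : dist (G (σ, 0)) (G (0, 0)) < ε / 4 := hball (by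
            rw [Prod.dist_eq, max_lt_iff, Real.dist_eq, Real.dist_eq]
            simp only [sub_zero, abs_zero]
            rw [abs_of_pos hσ.1]
            exact ⟨hσ.2.trans_lt hhδ, hδ⟩)
          rw [Real.dist_eq, abs_lt] at d1 d2
          rw [Real.norm_eq_abs, abs_le]
          constructor <;> linarith [d1.1, d1.2, d2.1, d2.2])
      simpa [Measure.real, hh0.le] using this
    rw [integral_sub hi (integrable_const _)] at hb1
    simp only [setIntegral_const, Measure.real, Real.volume_Ioc, sub_zero,
      ENNReal.toReal_ofReal hh0.le, smul_eq_mul, Real.norm_eq_abs] at hb1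
    rw [Real.dist_eq]
    have e : h⁻¹ * (∫ σ in Ioc 0 h, (G (σ, h) + G (σ, 0))) - 2 * G (0, 0)
        = h⁻¹ * ((∫ σ in Ioc 0 h, (G (σ, h) + G (σ, 0))) - h * (2 * G (0, 0))) := by
      field_simp
    rw [e, abs_mul, abs_of_pos (inv_pos.2 hh0)]
    calc h⁻¹ * |(∫ σ in Ioc 0 h, (G (σ, h) + G (σ, 0))) - h * (2 * G (0, 0))|
        ≤ h⁻¹ * (ε / 2 * h) := by gcongr
      _ = ε / 2 := by field_simp
      _ < ε := by linarith
  rw [← hG0]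
  exact tendsto_nhds_unique hlim1 hlim2

end Lions

/-! ### Lions–Magenes: the continuous representative -/

lemma Icc_subset_closure_of_ae {T : Set ℝ} (hT : ∀ᵐ t ∂timeMeasure, t ∈ T) :
    Icc (0 : ℝ) 1 ⊆ closure T := by
  rw [← closure_Ioo zero_ne_one]
  refine closure_minimal (fun x hx => ?_) isClosed_closure
  rw [mem_closure_iff]
  intro o ho hxo
  by_contra hne
  rw [not_nonempty_iff_eq_empty] at hne
  have hpos : 0 < volume (o ∩ Ioo (0 : ℝ) 1) :=
    (ho.inter isOpen_Ioo).measure_pos volume ⟨x, hxo, hx⟩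
  rw [timeMeasure, ae_restrict_iff' measurableSet_Icc, ae_iff] at hT
  refine hpos.ne' (measure_mono_null (fun y hy => ?_) hT)
  simp only [mem_ofPred_eq, Classical.not_imp]
  refine ⟨Ioo_subset_Icc_self hy.2, fun hyT => ?_⟩
  have : y ∈ o ∩ T := ⟨hy.1, hyT⟩
  simp [hne] at this

/-- Extension by zero makes time translations available on the whole line. -/
lemma exists_memLp_extension {E : Type*} [NormedAddCommGroup E] {f : ℝ → E}
    (hf : MemLp f 2 timeMeasure) :
    ∃ g : ℝ → E, MemLp g 2 volume ∧ ∀ t ∈ Icc (0 : ℝ) 1, g t = f t := by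
  refine ⟨(Icc (0 : ℝ) 1).indicator f, ?_, fun t ht => ?_⟩
  · rw [memLp_indicator_iff_restrict measurableSet_Icc]
    exact hf
  · rw [indicator_of_mem ht]

section Lions
variable {V H : Type*} [NormedAddCommGroup V] [NormedSpace ℝ V] [NormedAddCommGroup H]
  [InnerProductSpace ℝ H]

/-- Off a null set of times, `u` has limits in `H` at every time. -/
lemma exists_tendsto_of_energy_identity [CompleteSpace H] (j : V →L[ℝ] H) {u : ℝ → V}
    {w : ℝ → StrongDual ℝ V} (hu : MemLp u 2 volume) (hw : MemLp w 2 volume) {T : Set ℝ}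
    (hT : ∀ᵐ t ∂timeMeasure, t ∈ T) (hT01 : T ⊆ Icc 0 1)
    (huw : ∀ s ∈ T, ∀ t ∈ T, ∀ v : V, inner ℝ (j (u t) - j (u s)) (j v) = (∫ x in s..t, w x) v)
    (henergy : ∀ s ∈ T, ∀ t ∈ T,
      ‖j (u t)‖ ^ 2 - ‖j (u s)‖ ^ 2 = 2 * ∫ x in s..t, w x (u x))
    {t₀ : ℝ} (ht₀ : t₀ ∈ Icc (0 : ℝ) 1) :
    ∃ y, Tendsto (fun t => j (u t)) (𝓝[T] t₀) (𝓝 y) := by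
  have hne : (𝓝[T] t₀).NeBot := mem_closure_iff_nhdsWithin_neBot.1 (Icc_subset_closure_of_ae hT ht₀)
  have hui : Integrable (fun x => ‖u x‖ ^ 2) := hu.integrable_norm_pow (by norm_num)
  have hwi : Integrable (fun x => ‖w x‖ ^ 2) := hw.integrable_norm_pow (by norm_num)
  have hwl : ∀ a b, IntervalIntegrable w volume a b := fun a b =>
    ((hw.locallyIntegrable one_le_two).integrableOn_isCompact isCompact_uIcc).intervalIntegrable
  set e : ℝ → ℝ := fun x => ‖u x‖ ^ 2 + ‖w x‖ ^ 2 with he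
  have hei : Integrable e := hui.add hwi
  have he0 : ∀ x, 0 ≤ e x := fun x => by positivity
  have hQ : Continuous (fun x => ∫ y in (0 : ℝ)..x, e y) :=
    intervalIntegral.continuous_primitive (fun a b => hei.intervalIntegrable) 0
  -- on a short interval all values are close to the value at a well chosen time
  have hclose : ∀ a b : ℝ, 0 ≤ a → a < b → b ≤ 1 → ∃ σ, ∀ t ∈ T, t ∈ Icc a b →
      ‖j (u t) - j (u σ)‖ ^ 2 ≤ 2 * ∫ x in a..b, e x := by
    intro a b h0a hab hb1
    have hnull : (volume.restrict (Icc a b)) (T ∩ Icc a b)ᶜ = 0 := by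
      have h1 : ∀ᵐ t ∂(volume.restrict (Icc a b)), t ∈ T :=
        ae_restrict_of_ae_restrict_of_subset (Icc_subset_Icc h0a hb1) hT
      have h2 : ∀ᵐ t ∂(volume.restrict (Icc a b)), t ∈ T ∩ Icc a b :=
        h1.and (ae_restrict_mem measurableSet_Icc)
      exact h2
    -- At `σ` the `V`-norm squared is at most its mean over `[a,b]`, so the constant `‖u σ‖²`
    -- integrates to at most `∫ ‖u‖²` in `b2`.
    obtain ⟨σ, hσab, hσT, hσ⟩ : ∃ σ ∈ Icc a b, σ ∈ T ∧
        ‖u σ‖ ^ 2 * (b - a) ≤ ∫ x in a..b, ‖u x‖ ^ 2 := by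
      obtain ⟨σ, h1, h3⟩ := exists_notMem_null_le_average (by simp [hab])
        (hui.integrableOn (s := Icc a b)) hnull
      rw [mem_compl_iff, not_not] at h1
      refine ⟨σ, h1.2, h1.1, ?_⟩
      rw [setAverage_eq, smul_eq_mul, integral_Icc_eq_integral_Ioc,
        ← intervalIntegral.integral_of_le hab.le] at h3
      simp only [Measure.real, Real.volume_Icc, ENNReal.toReal_ofReal (sub_pos.2 hab).le] at h3
      have hpos : 0 < b - a := sub_pos.2 hab
      calc ‖u σ‖ ^ 2 * (b - a) ≤ ((b - a)⁻¹ * ∫ x in a..b, ‖u x‖ ^ 2) * (b - a) := by gcongr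
        _ = ∫ x in a..b, ‖u x‖ ^ 2 := by field_simp
    refine ⟨σ, fun t htT ht => ?_⟩
    have hsub : uIoc σ t ⊆ Ioc a b := by
      intro x hx
      exact ⟨(le_min hσab.1 ht.1).trans_lt hx.1, hx.2.trans (max_le hσab.2 ht.2)⟩
    have hwu : Integrable (fun x => w x (u x)) := integrable_dual_apply hw hu
    -- `‖x - y‖² = ‖x‖² - ‖y‖² - 2⟨x - y, y⟩`: the energy identity handles the first difference, the
    -- weak derivative tested with `u σ` the last term.
    have e1 : ‖j (u t) - j (u σ)‖ ^ 2
        = 2 * (∫ x in σ..t, w x (u x)) - 2 * ∫ x in σ..t, w x (u σ) := by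
      rw [← henergy σ hσT t htT, ← ContinuousLinearMap.intervalIntegral_apply (hwl _ _),
        ← huw σ hσT t htT, norm_sub_sq_real, inner_sub_left, real_inner_self_eq_norm_sq]
      ring
    have hE : ∫ x in a..b, e x = ∫ x in Ioc a b, e x := intervalIntegral.integral_of_le hab.le
    have b1 : 2 * (∫ x in σ..t, w x (u x)) ≤ ∫ x in a..b, e x := by
      have : ‖∫ x in σ..t, 2 * w x (u x)‖ ≤ ∫ x in Ioc a b, e x := by
        refine (intervalIntegral.norm_integral_le_integral_norm_uIoc).trans ?_
        calc ∫ x in uIoc σ t, ‖2 * w x (u x)‖ ≤ ∫ x in uIoc σ t, e x := by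
              refine integral_mono (hwu.const_mul 2).norm.integrableOn hei.integrableOn fun x => ?_
              have h1 := (w x).le_opNorm (u x)
              have h2 := two_mul_le_add_sq ‖u x‖ ‖w x‖
              simp only [norm_mul, Real.norm_ofNat, he]
              nlinarith
          _ ≤ ∫ x in Ioc a b, e x :=
              setIntegral_mono_set hei.integrableOn (Eventually.of_forall he0)
                (LE.le.eventuallyLE hsub)
      rw [intervalIntegral.integral_const_mul] at this
      rw [hE]
      exact (le_abs_self _).trans this
    have b2 : -(2 * ∫ x in σ..t, w x (u σ)) ≤ ∫ x in a..b, e x := by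
      have hloc : IntegrableOn (fun x => w x (u σ)) (Ioc a b) := by
        have := (hwl a b).1
        exact Integrable.apply_continuousLinearMap this (u σ)
      have : ‖∫ x in σ..t, 2 * w x (u σ)‖ ≤ ∫ x in Ioc a b, (‖u σ‖ ^ 2 + ‖w x‖ ^ 2) := by
        refine (intervalIntegral.norm_integral_le_integral_norm_uIoc).trans ?_
        calc ∫ x in uIoc σ t, ‖2 * w x (u σ)‖ ≤ ∫ x in Ioc a b, ‖2 * w x (u σ)‖ :=
              setIntegral_mono_set (hloc.const_mul 2).norm
                (Eventually.of_forall fun x => norm_nonneg _)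
                (LE.le.eventuallyLE hsub)
          _ ≤ ∫ x in Ioc a b, (‖u σ‖ ^ 2 + ‖w x‖ ^ 2) := by
              refine integral_mono (hloc.const_mul 2).norm
                ((integrable_const _).add hwi.integrableOn) fun x => ?_
              have h1 := (w x).le_opNorm (u σ)
              have h2 := two_mul_le_add_sq ‖u σ‖ ‖w x‖
              simp only [norm_mul, Real.norm_ofNat]
              nlinarith
      rw [intervalIntegral.integral_const_mul, integral_add (integrable_const _) hwi.integrableOn,
        setIntegral_const, Measure.real, Real.volume_Ioc, ENNReal.toReal_ofReal (sub_pos.2 hab).le,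
        smul_eq_mul, mul_comm (b - a)] at this
      rw [hE, integral_add hui.integrableOn hwi.integrableOn,
        ← intervalIntegral.integral_of_le hab.le]
      have h3 := (neg_le_abs _).trans this
      linarith
    rw [e1]
    linarith
  have hcauchy : Cauchy (map (fun t => j (u t)) (𝓝[T] t₀)) := by
    rw [Metric.cauchy_iff]
    refine ⟨inferInstance, fun ε hε => ?_⟩
    -- The two endpoints give `∫ e < ε²/16`, so squared distances to `j (u σ)` are below `ε²/8 <
    -- (ε/2)²`.
    obtain ⟨δ, hδ, hball⟩ := Metric.continuousAt_iff.1 (hQ.continuousAt (x := t₀)) (ε ^ 2 / 32)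
      (by positivity)
    set a := max 0 (t₀ - δ / 2) with ha
    set b := min 1 (t₀ + δ / 2) with hb
    have hab : a < b := by
      rw [ha, hb]
      refine max_lt (lt_min one_pos ?_) (lt_min ?_ ?_) <;> linarith [ht₀.1, ht₀.2]
    obtain ⟨σ, hσ⟩ := hclose a b (le_max_left _ _) hab (min_le_left _ _)
    have hadist : dist a t₀ < δ := by
      rw [Real.dist_eq, abs_lt]
      have h1 : a ≤ t₀ := max_le ht₀.1 (by linarith)
      have h2 : t₀ - δ / 2 ≤ a := le_max_right _ _
      constructor <;> linarith
    have hbdist : dist b t₀ < δ := by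
      rw [Real.dist_eq, abs_lt]
      have h1 : t₀ ≤ b := le_min ht₀.2 (by linarith)
      have h2 : b ≤ t₀ + δ / 2 := min_le_right _ _
      constructor <;> linarith
    have hE : ∫ x in a..b, e x < ε ^ 2 / 16 := by
      rw [← intervalIntegral.integral_interval_sub_left (a := 0) hei.intervalIntegrable
        hei.intervalIntegrable]
      have h1 := hball hadist
      have h2 := hball hbdist
      rw [Real.dist_eq, abs_lt] at h1 h2
      linarith [h1.1, h2.2]
    have hd : ∀ t ∈ T, t ∈ Icc a b → ‖j (u t) - j (u σ)‖ < ε / 2 := by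
      intro t h1 h2
      have := hσ t h1 h2
      refine lt_of_pow_lt_pow_left₀ 2 (by positivity) (this.trans_lt ?_)
      nlinarith [sq_pos_of_pos hε]
    refine ⟨(fun t => j (u t)) '' (T ∩ Icc a b), image_mem_map ?_, ?_⟩
    · have hmem : Ioo (t₀ - δ / 2) (t₀ + δ / 2) ∈ 𝓝 t₀ :=
        Ioo_mem_nhds (by linarith) (by linarith)
      filter_upwards [self_mem_nhdsWithin, mem_nhdsWithin_of_mem_nhds hmem] with t h1 h2
      have h3 := hT01 h1
      exact ⟨h1, max_le h3.1 h2.1.le, le_min h3.2 h2.2.le⟩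
    · rintro _ ⟨s, hs, rfl⟩ _ ⟨t, ht, rfl⟩
      calc dist (j (u s)) (j (u t)) ≤ dist (j (u s)) (j (u σ)) + dist (j (u t)) (j (u σ)) :=
            dist_triangle_right _ _ _
        _ < ε / 2 + ε / 2 := by
            rw [dist_eq_norm, dist_eq_norm]
            exact add_lt_add (hd s hs.1 hs.2) (hd t ht.1 ht.2)
        _ = ε := by ring
  exact cauchy_map_iff_exists_tendsto.1 hcauchy

/-- The Lions–Magenes lemma: if `u ∈ L²([0,1]; V)` has a weak derivative `w ∈ L²([0,1]; V*)`, then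
`u` has a continuous representative with values in `H`, and `d/dt ‖u‖² = 2 ⟨w, u⟩`. -/
theorem exists_continuous_representative [SecondCountableTopology V] [CompleteSpace H]
    (j : V →L[ℝ] H) {u : ℝ → V} {w : ℝ → StrongDual ℝ V} (hu : MemLp u 2 timeMeasure)
    (hw : MemLp w 2 timeMeasure)
    (huw : ∀ ψ : ℝ → ℝ, ContDiff ℝ ∞ ψ → HasCompactSupport ψ → tsupport ψ ⊆ Ioo 0 1 → ∀ v : V,
      ∫ t, deriv ψ t * inner ℝ (j (u t)) (j v) ∂timeMeasure = -∫ t, ψ t * w t v ∂timeMeasure) :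
    ∃ U : ℝ → H, ContinuousOn U (Icc 0 1) ∧ (∀ᵐ t ∂timeMeasure, U t = j (u t)) ∧
      ∀ s ∈ Icc (0 : ℝ) 1, ∀ t ∈ Icc (0 : ℝ) 1,
        ‖U t‖ ^ 2 - ‖U s‖ ^ 2 = 2 * ∫ x in s..t, w x (u x) := by
  obtain ⟨T, hT, hT01, hTw⟩ := exists_times_inner_sub_eq j hu hw huw
  obtain ⟨u', hu2, hue⟩ := exists_memLp_extension hu
  obtain ⟨w', hw2, hwe⟩ := exists_memLp_extension hw
  have hTw' : ∀ s ∈ T, ∀ t ∈ T, ∀ v : V,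
      inner ℝ (j (u' t) - j (u' s)) (j v) = (∫ x in s..t, w' x) v := by
    intro s hs t ht v
    have h : ∫ x in s..t, w' x = ∫ x in s..t, w x :=
      intervalIntegral.integral_congr fun x hx =>
        hwe x (ordConnected_Icc.uIcc_subset (hT01 hs) (hT01 ht) hx)
    rw [hue t (hT01 ht), hue s (hT01 hs), hTw s hs t ht, h]
  obtain ⟨S, hST, hS, hSe⟩ := exists_times_energy_identity j hu2 hw2 hT hTw'
  have hS01 := hST.trans hT01
  have hlim : ∀ t ∈ Icc (0 : ℝ) 1, ∃ y, Tendsto (fun t => j (u' t)) (𝓝[S] t) (𝓝 y) := fun t ht =>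
    exists_tendsto_of_energy_identity j hu2 hw2 hS hS01
      (fun s hs t ht v => hTw' s (hST hs) t (hST ht) v) hSe ht
  have hcl := Icc_subset_closure_of_ae hS
  set U := extendFrom S (fun t => j (u' t)) with hU
  have hUc : ContinuousOn U (Icc 0 1) := continuousOn_extendFrom hcl hlim
  have hUS : ∀ t ∈ S, U t = j (u' t) := by
    intro t ht
    obtain ⟨y, hy⟩ := hlim t (hS01 ht)
    have h1 : j (u' t) = y :=
      tendsto_nhds_unique (tendsto_pure_nhds _ _) (hy.mono_left (pure_le_nhdsWithin ht))
    rw [h1]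
    exact extendFrom_eq (hcl (hS01 ht)) hy
  refine ⟨U, hUc, ?_, ?_⟩
  · filter_upwards [hS] with t ht
    rw [hUS t ht, hue t (hS01 ht)]
  · have hwu : Integrable (fun x => w' x (u' x)) := integrable_dual_apply hw2 hu2
    have hA : Continuous (fun t => ∫ x in (0 : ℝ)..t, w' x (u' x)) :=
      intervalIntegral.continuous_primitive (fun a b => hwu.intervalIntegrable) 0
    -- Both sides are continuous in `t` and agree on the dense set `S`.
    have key : ∀ s ∈ S, EqOn (fun t => ‖U t‖ ^ 2)
        (fun t => ‖U s‖ ^ 2 + 2 * ((∫ x in (0 : ℝ)..t, w' x (u' x)) -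
          ∫ x in (0 : ℝ)..s, w' x (u' x))) (Icc 0 1) := by
      intro s hs
      refine EqOn.of_subset_closure (s := S) (fun t ht => ?_) (hUc.norm.pow 2) (by fun_prop)
        hS01 hcl
      rw [hUS s hs, hUS t ht, intervalIntegral.integral_interval_sub_left hwu.intervalIntegrable
        hwu.intervalIntegrable, ← hSe s hs t ht]
      ring
    obtain ⟨s₀, hs₀⟩ : S.Nonempty := by
      rw [← closure_nonempty_iff]
      exact ⟨0, hcl (by simp)⟩
    intro s hs t ht
    have h1 := key s₀ hs₀ hs
    have h2 := key s₀ hs₀ ht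
    simp only at h1 h2
    have h3 : ∫ x in s..t, w x (u x) = ∫ x in s..t, w' x (u' x) :=
      intervalIntegral.integral_congr fun x hx => by
        have hx' := ordConnected_Icc.uIcc_subset hs ht hx
        simp only [hwe x hx', hue x hx']
    rw [h3, ← intervalIntegral.integral_interval_sub_left (a := 0) hwu.intervalIntegrable
        hwu.intervalIntegrable]
    linarith

end Lions

/-! ### Grönwall's inequality -/

/-- Grönwall's inequality with an integrable coefficient. -/
lemma le_two_pow_mul_of_sub_le_integral {F κ : ℝ → ℝ} (hF : ContinuousOn F (Icc 0 1))
    (hF0 : ∀ t ∈ Icc (0 : ℝ) 1, 0 ≤ F t) (hκ : Integrable κ timeMeasure) (hκ0 : ∀ t, 0 ≤ κ t)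
    (h : ∀ s ∈ Icc (0 : ℝ) 1, ∀ t ∈ Icc (0 : ℝ) 1, s ≤ t → F t - F s ≤ ∫ x in s..t, κ x * F x)
    (n : ℕ) : ∀ t ∈ Icc (0 : ℝ) 1, ∫ x in (0 : ℝ)..t, κ x ≤ n / 2 → F t ≤ 2 ^ n * F 0 := by
  have hii : ∀ a ∈ Icc (0 : ℝ) 1, ∀ b ∈ Icc (0 : ℝ) 1, IntervalIntegrable κ volume a b :=
    fun a ha b hb => intervalIntegrable_of_mem_Icc hκ ha hb
  have h0 : (0 : ℝ) ∈ Icc (0 : ℝ) 1 := by simp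
  -- `m` is the maximum of `F` on `[s,t]`. Where `∫ κ ≤ 1/2` this yields `m ≤ 2 F s`; each such
  -- stretch of time costs a factor `2`.
  have hstep : ∀ s ∈ Icc (0 : ℝ) 1, ∀ t ∈ Icc (0 : ℝ) 1, s ≤ t →
      ∃ m, F t ≤ m ∧ 0 ≤ m ∧ m ≤ F s + m * ∫ x in s..t, κ x := by
    intro s hs t ht hst
    have hsub : Icc s t ⊆ Icc 0 1 := Icc_subset_Icc hs.1 ht.2
    obtain ⟨x, hx, hmax⟩ := isCompact_Icc.exists_isMaxOn (nonempty_Icc.2 hst) (hF.mono hsub)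
    refine ⟨F x, hmax (right_mem_Icc.2 hst), hF0 x (hsub hx), ?_⟩
    have h1 := h s hs x (hsub hx) hx.1
    have h2 : ∫ y in s..x, κ y * F y ≤ ∫ y in s..x, κ y * F x := by
      refine intervalIntegral.integral_mono_on hx.1 ?_ ((hii s hs x (hsub hx)).mul_const _) ?_
      · refine (hii s hs x (hsub hx)).mul_continuousOn (hF.mono ?_)
        exact ordConnected_Icc.uIcc_subset hs (hsub hx)
      · intro y hy
        exact mul_le_mul_of_nonneg_left (hmax ⟨hy.1, hy.2.trans hx.2⟩) (hκ0 y)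
    rw [intervalIntegral.integral_mul_const] at h2
    have h3 : ∫ y in s..x, κ y ≤ ∫ y in s..t, κ y :=
      intervalIntegral.integral_mono_interval le_rfl hx.1 hx.2 (Eventually.of_forall hκ0)
        (hii s hs t ht)
    have h4 := mul_le_mul_of_nonneg_right h3 (hF0 x (hsub hx))
    linarith
  have hF00 := hF0 0 h0
  induction n with
  | zero =>
    intro t ht hK
    obtain ⟨m, h1, h2, h3⟩ := hstep 0 h0 t ht ht.1
    simp only [CharP.cast_eq_zero, zero_div] at hK
    have := mul_nonpos_of_nonneg_of_nonpos h2 hK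
    simp only [pow_zero, one_mul]
    linarith
  | succ n ih =>
    intro t ht hK
    rcases le_or_gt (∫ x in (0 : ℝ)..t, κ x) (n / 2) with hle | hlt
    · have := ih t ht hle
      have h2 : (0 : ℝ) ≤ 2 ^ n * F 0 := by positivity
      rw [pow_succ]
      linarith
    · have hcont : ContinuousOn (fun t => ∫ x in (0 : ℝ)..t, κ x) (Icc 0 t) := by
        have := intervalIntegral.continuousOn_primitive_interval' (hii 0 h0 t ht) left_mem_uIcc
        rwa [uIcc_of_le ht.1] at this
      -- The time `s` at which the budget `n/2` is used up; at most `1/2` remains on `[s,t]`.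
      obtain ⟨s, hs, hsK⟩ : ((n : ℝ) / 2) ∈ (fun t => ∫ x in (0 : ℝ)..t, κ x) '' Icc 0 t :=
        intermediate_value_Icc ht.1 hcont ⟨by simp; positivity, hlt.le⟩
      simp only at hsK
      have hs01 : s ∈ Icc (0 : ℝ) 1 := ⟨hs.1, hs.2.trans ht.2⟩
      have h1 := ih s hs01 hsK.le
      obtain ⟨m, hm1, hm2, hm3⟩ := hstep s hs01 t ht hs.2
      have h2 : ∫ x in s..t, κ x ≤ 1 / 2 := by
        rw [← intervalIntegral.integral_interval_sub_left (hii 0 h0 t ht) (hii 0 h0 s hs01), hsK]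
        push_cast at hK
        linarith
      have h3 := mul_le_mul_of_nonneg_left h2 hm2
      rw [pow_succ]
      linarith

/-! ### Approximation of Sobolev functions by test functions -/

/-- Convolution with a probability density does not increase the `L²` norm. -/
lemma eLpNorm_convolution_le {d : ℕ} {E : Type*} [NormedAddCommGroup E] [NormedSpace ℝ E]
    {φ : Space d → ℝ} (hφ : Continuous φ) (hφ1 : ∫⁻ x, ‖φ x‖ₑ = 1)
    {f : Space d → E} (hf : StronglyMeasurable f) :
    eLpNorm (convolution φ f (ContinuousLinearMap.lsmul ℝ ℝ) volume) 2 volume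
      ≤ eLpNorm f 2 volume := by
  rw [eLpNorm_eq_lintegral_rpow_enorm_toReal (by norm_num) (by norm_num),
    eLpNorm_eq_lintegral_rpow_enorm_toReal (by norm_num) (by norm_num)]
  simp only [ENNReal.toReal_ofNat, ENNReal.rpow_ofNat]
  gcongr ?_ ^ _
  have hm : Measurable (fun p : Space d × Space d => ‖φ p.2‖ₑ * ‖f (p.1 - p.2)‖ₑ ^ 2) :=
    ((hφ.measurable.comp measurable_snd).enorm).mul
      (((hf.comp_measurable (measurable_fst.sub measurable_snd)).enorm).pow_const 2)
  calc ∫⁻ x, ‖convolution φ f (ContinuousLinearMap.lsmul ℝ ℝ) volume x‖ₑ ^ 2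
      ≤ ∫⁻ x, ∫⁻ t, ‖φ t‖ₑ * ‖f (x - t)‖ₑ ^ 2 := by
        refine lintegral_mono fun x => ?_
        have hfx : Measurable (fun t => ‖f (x - t)‖ₑ) :=
          (hf.comp_measurable (measurable_const.sub measurable_id)).enorm
        have h1 : ‖convolution φ f (ContinuousLinearMap.lsmul ℝ ℝ) volume x‖ₑ
            ≤ ∫⁻ t, ‖φ t‖ₑ * ‖f (x - t)‖ₑ := by
          refine (enorm_integral_le_lintegral_enorm _).trans (lintegral_mono fun t => ?_)
          simp [enorm_smul]
        -- Cauchy–Schwarz for the splitting `|φ||f| = |φ|^{1/2} (|φ||f|²)^{1/2}`; the first factor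
        -- has integral one after squaring.
        have h2 := ENNReal.lintegral_mul_norm_pow_le (μ := (volume : Measure (Space d)))
          (f := fun t => ‖φ t‖ₑ) (g := fun t => ‖φ t‖ₑ * ‖f (x - t)‖ₑ ^ 2)
          hφ.measurable.enorm.aemeasurable
          (hφ.measurable.enorm.mul (hfx.pow_const 2)).aemeasurable
          (p := 1 / 2) (q := 1 / 2) (by norm_num) (by norm_num) (by norm_num)
        have h3 : ∀ t, ‖φ t‖ₑ ^ (1 / 2 : ℝ) * (‖φ t‖ₑ * ‖f (x - t)‖ₑ ^ 2) ^ (1 / 2 : ℝ)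
            = ‖φ t‖ₑ * ‖f (x - t)‖ₑ := by
          intro t
          rw [ENNReal.mul_rpow_of_nonneg _ _ (by norm_num), ← mul_assoc,
            ← ENNReal.rpow_add_of_nonneg _ _ (by norm_num) (by norm_num), ← ENNReal.rpow_natCast,
            ← ENNReal.rpow_mul]
          norm_num
        simp only [h3, hφ1, ENNReal.one_rpow, one_mul] at h2
        calc ‖convolution φ f (ContinuousLinearMap.lsmul ℝ ℝ) volume x‖ₑ ^ 2
            ≤ ((∫⁻ t, ‖φ t‖ₑ * ‖f (x - t)‖ₑ ^ 2) ^ (1 / 2 : ℝ)) ^ 2 := by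
              gcongr
              exact h1.trans h2
          _ = _ := by
              rw [← ENNReal.rpow_natCast, ← ENNReal.rpow_mul]
              norm_num
    _ = ∫⁻ t, ∫⁻ x, ‖φ t‖ₑ * ‖f (x - t)‖ₑ ^ 2 := lintegral_lintegral_swap hm.aemeasurable
    _ = ∫⁻ t, ‖φ t‖ₑ * ∫⁻ x, ‖f x‖ₑ ^ 2 := by
        congr 1 with t
        rw [lintegral_const_mul _ ((show Measurable fun x => ‖f (x - t)‖ₑ from (hf.comp_measurable
          (measurable_id.sub measurable_const)).enorm).pow_const 2),
          lintegral_sub_right_eq_self (fun x => ‖f x‖ₑ ^ 2) t]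
    _ = ∫⁻ x, ‖f x‖ₑ ^ 2 := by
        rw [lintegral_mul_const _ hφ.measurable.enorm, hφ1, one_mul]

/-- The gradient of a mollification is the mollification of the weak gradient. -/
lemma norm_fderiv_convolution_le {d : ℕ} {φ : Space d → ℝ} (hφ : ContDiff ℝ ∞ φ)
    (hc : HasCompactSupport φ) {f : L2 d} {g : L2Vec d} (hfg : IsWeakGradient f g) (x : Space d) :
    ‖fderiv ℝ (convolution φ f (ContinuousLinearMap.lsmul ℝ ℝ) volume) x‖
      ≤ ‖convolution φ g (ContinuousLinearMap.lsmul ℝ ℝ) volume x‖ := by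
  have hfl : LocallyIntegrable f volume := (Lp.memLp f).locallyIntegrable (by norm_num)
  have hgl : LocallyIntegrable g volume := (Lp.memLp g).locallyIntegrable (by norm_num)
  refine ContinuousLinearMap.opNorm_le_bound _ (norm_nonneg _) fun e => ?_
  have hd := hc.hasFDerivAt_convolution_left (ContinuousLinearMap.lsmul ℝ ℝ)
    (hφ.of_le (by simp)) hfl x
  have hint : ConvolutionExistsAt (fderiv ℝ φ) f x
      ((ContinuousLinearMap.lsmul ℝ ℝ).precompL (Space d)) volume :=
    hc.fderiv (𝕜 := ℝ) |>.convolutionExists_left _ (hφ.continuous_fderiv (by simp)) hfl x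
  have hgint : ConvolutionExistsAt φ g x (ContinuousLinearMap.lsmul ℝ ℝ) volume :=
    hc.convolutionExists_left _ hφ.continuous hgl x
  have h1 : fderiv ℝ (convolution φ f (ContinuousLinearMap.lsmul ℝ ℝ) volume) x e
      = ∫ t, f t * fderiv ℝ φ (x - t) e := by
    rw [hd.fderiv, convolution, ContinuousLinearMap.integral_apply hint,
      ← integral_sub_left_eq_self _ _ x]
    congr 1 with t
    simp [ContinuousLinearMap.precompL_apply, mul_comm]
  have h2 : ∀ t, fderiv ℝ (fun t => φ (x - t)) t e = -fderiv ℝ φ (x - t) e := by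
    intro t
    have := (((hφ.differentiable (by simp)) (x - t)).hasFDerivAt.comp t
      ((hasFDerivAt_id t).const_sub x)).fderiv
    simp only [Function.comp_def] at this
    rw [this]
    simp
  -- The reflected translate of `φ` is the test function; its sign change cancels the one in the
  -- weak gradient.
  have h3 := hfg (fun t => φ (x - t)) (hφ.comp (contDiff_const.sub contDiff_id))
    (hc.comp_homeomorph (Homeomorph.subLeft x)) e
  simp only [h2, mul_neg, integral_neg, neg_inj] at h3
  have h4 : ∫ t, φ (x - t) * inner ℝ (g t) e
      = inner ℝ (convolution φ g (ContinuousLinearMap.lsmul ℝ ℝ) volume x) e := by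
    rw [real_inner_comm, convolution, ← integral_inner hgint, ← integral_sub_left_eq_self _ _ x]
    congr 1 with t
    simp [real_inner_smul_right, real_inner_comm]
  rw [h1, h3, h4]
  exact norm_inner_le_norm _ _

/-- Approximation of Sobolev functions by test functions. -/
lemma exists_test_function_approximation {d : ℕ} {f : L2 d} {g : L2Vec d}
    (hfg : IsWeakGradient f g) :
    ∃ (K : ℝ≥0) (h : ℕ → Space d → ℝ), (∀ n, ContDiff ℝ 1 (h n)) ∧ (∀ n, HasCompactSupport (h n)) ∧
      (∀ n, eLpNorm (h n) 2 volume ≤ eLpNorm f 2 volume) ∧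
      (∀ n : ℕ, eLpNorm (fderiv ℝ (h n)) 2 volume
        ≤ eLpNorm g 2 volume + (K * (n + 1 : ℝ≥0)⁻¹ : ℝ≥0) * eLpNorm f 2 volume) ∧
      ∀ᵐ x, Tendsto (fun n => h n x) atTop (𝓝 (f x)) := by
  have hfl : LocallyIntegrable f volume := (Lp.memLp f).locallyIntegrable (by norm_num)
  let φ : ℕ → ContDiffBump (0 : Space d) := fun n =>
    ⟨1 / ((n : ℝ) + 1), 2 / ((n : ℝ) + 1), by positivity, by gcongr; norm_num⟩
  let χ : ContDiffBump (0 : Space d) := ⟨1, 2, by norm_num, by norm_num⟩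
  let F : ℕ → Space d → ℝ := fun n =>
    convolution ((φ n).normed volume) f (ContinuousLinearMap.lsmul ℝ ℝ) volume
  have hφ1 : ∀ n, ∫⁻ x, ‖(φ n).normed volume x‖ₑ = 1 := by
    intro n
    rw [← ofReal_integral_norm_eq_lintegral_enorm (φ n).integrable_normed]
    simp only [Real.norm_of_nonneg ((φ n).nonneg_normed _), (φ n).integral_normed,
      ENNReal.ofReal_one]
  have hFs : ∀ n, ContDiff ℝ 1 (F n) := fun n =>
    (φ n).hasCompactSupport_normed.contDiff_convolution_left (n := 1) _ (φ n).contDiff_normed hfl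
  have hFn : ∀ n, eLpNorm (F n) 2 volume ≤ eLpNorm f 2 volume := fun n =>
    eLpNorm_convolution_le (φ n).continuous_normed (hφ1 n) (Lp.stronglyMeasurable f)
  have hFd : ∀ n, eLpNorm (fderiv ℝ (F n)) 2 volume ≤ eLpNorm g 2 volume := fun n =>
    (eLpNorm_mono (norm_fderiv_convolution_le (φ n).contDiff_normed
      (φ n).hasCompactSupport_normed hfg)).trans
    (eLpNorm_convolution_le (φ n).continuous_normed (hφ1 n) (Lp.stronglyMeasurable g))
  have hFt : ∀ᵐ x, Tendsto (fun n => F n x) atTop (𝓝 (f x)) := by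
    refine ContDiffBump.ae_convolution_tendsto_right_of_locallyIntegrable (K := 2) ?_ ?_ hfl
    · have := (tendsto_one_div_add_atTop_nhds_zero_nat (𝕜 := ℝ)).const_mul 2
      rw [mul_zero] at this
      refine this.congr fun n => ?_
      simp only [φ]
      ring
    · refine Eventually.of_forall fun n => le_of_eq ?_
      simp only [φ]
      ring
  obtain ⟨K, hK⟩ : ∃ K : ℝ≥0, ∀ x, ‖fderiv ℝ χ x‖ ≤ K := by
    have hcs : HasCompactSupport (fderiv ℝ χ) := χ.hasCompactSupport.fderiv (𝕜 := ℝ)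
    obtain ⟨C, hC⟩ := hcs.exists_bound_of_continuous
      ((χ.contDiff (n := 1)).continuous_fderiv (by simp))
    exact ⟨C.toNNReal, fun x => (hC x).trans (Real.le_coe_toNNReal C)⟩
  -- Cutoff at scale `n + 1`: its gradient is `O(1/(n+1))`, which is the error term in the gradient
  -- bound.
  let c : ℕ → Space d → ℝ := fun n x => χ ((n + 1 : ℝ)⁻¹ • x)
  have hcs : ∀ n, ContDiff ℝ 1 (c n) := fun n => χ.contDiff.comp (contDiff_const_smul _)
  have hc1 : ∀ n x, ‖c n x‖ ≤ 1 := fun n x => by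
    rw [Real.norm_of_nonneg χ.nonneg]
    exact χ.le_one
  have hcd : ∀ n x, ‖fderiv ℝ (c n) x‖ ≤ K * (n + 1 : ℝ)⁻¹ := by
    intro n x
    have hd : HasFDerivAt (c n) ((fderiv ℝ χ ((n + 1 : ℝ)⁻¹ • x)).comp
        ((n + 1 : ℝ)⁻¹ • ContinuousLinearMap.id ℝ (Space d))) x :=
      (((χ.contDiff (n := 1)).differentiable (by simp) _).hasFDerivAt).comp x
        ((hasFDerivAt_id x).const_smul ((n + 1 : ℝ)⁻¹) :
          HasFDerivAt (fun x => (n + 1 : ℝ)⁻¹ • x) _ x)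
    rw [hd.fderiv, ContinuousLinearMap.comp_smul, ContinuousLinearMap.comp_id, norm_smul, mul_comm,
      Real.norm_of_nonneg (by positivity)]
    gcongr
    exact hK _
  refine ⟨K, fun n x => c n x * F n x, fun n => (hcs n).mul (hFs n), fun n => ?_, fun n => ?_,
    fun n => ?_, ?_⟩
  · refine HasCompactSupport.mul_right ?_
    exact χ.hasCompactSupport.comp_homeomorph
      (Homeomorph.smulOfNeZero ((n + 1 : ℝ)⁻¹) (by positivity))
  · refine (eLpNorm_mono fun x => ?_).trans (hFn n)
    rw [norm_mul]
    exact mul_le_of_le_one_left (norm_nonneg _) (hc1 n x)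
  · have hpt : ∀ x, ‖fderiv ℝ (fun x => c n x * F n x) x‖
        ≤ ‖‖fderiv ℝ (F n) x‖ + (K * (n + 1 : ℝ≥0)⁻¹ : ℝ≥0) • ‖F n x‖‖ := by
      intro x
      rw [fderiv_fun_mul ((hcs n).differentiable (by simp) x) ((hFs n).differentiable (by simp) x)]
      refine (norm_add_le _ _).trans (le_trans ?_ (le_abs_self _))
      rw [norm_smul, norm_smul, NNReal.smul_def, smul_eq_mul]
      refine add_le_add (mul_le_of_le_one_left (norm_nonneg _) (hc1 n x)) ?_
      rw [mul_comm]
      gcongr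
      exact_mod_cast hcd n x
    refine (eLpNorm_mono hpt).trans ((eLpNorm_add_le ?_ ?_ (by norm_num)).trans ?_)
    · exact ((hFs n).continuous_fderiv (by simp)).norm.aestronglyMeasurable
    · exact ((hFs n).continuous.norm.const_smul _).aestronglyMeasurable
    · rw [eLpNorm_norm]
      refine add_le_add (hFd n) ?_
      have : (fun x => (K * (n + 1 : ℝ≥0)⁻¹ : ℝ≥0) • ‖F n x‖)
          = ((K * (n + 1 : ℝ≥0)⁻¹ : ℝ≥0) : ℝ) • fun x => ‖F n x‖ := rfl
      rw [this, eLpNorm_const_smul, eLpNorm_norm]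
      refine mul_le_mul' (le_of_eq ?_) (hFn n)
      rw [Real.enorm_eq_ofReal NNReal.zero_le_coe, ENNReal.ofReal_coe_nnreal]
  · filter_upwards [hFt] with x hx
    have h1 : Tendsto (fun n : ℕ => c n x) atTop (𝓝 1) := by
      have h2 : Tendsto (fun n : ℕ => ((n + 1 : ℝ)⁻¹ • x)) atTop (𝓝 0) := by
        have := (tendsto_one_div_add_atTop_nhds_zero_nat (𝕜 := ℝ)).smul_const x
        simpa using this
      have h3 := (χ.contDiff (n := 0)).continuous.tendsto 0
      rw [χ.one_of_mem_closedBall (Metric.mem_closedBall_self χ.rIn_pos.le)] at h3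
      exact h3.comp h2
    simpa using h1.mul hx

/-- Multiplicative inequalities for test functions extend to Sobolev functions. -/
lemma eLpNorm_le_of_forall_test_function {d : ℕ} {p : ℝ≥0∞} {C : ℝ≥0} {a b : ℝ} (ha : 0 ≤ a)
    (hb : 0 ≤ b)
    (hC : ∀ h : Space d → ℝ, ContDiff ℝ 1 h → HasCompactSupport h →
      eLpNorm h p volume ≤ C * eLpNorm h 2 volume ^ a * eLpNorm (fderiv ℝ h) 2 volume ^ b)
    {f : L2 d} {g : L2Vec d} (hfg : IsWeakGradient f g) :
    eLpNorm f p volume ≤ C * eLpNorm f 2 volume ^ a * eLpNorm g 2 volume ^ b := by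
  obtain ⟨K, h, h1, h2, h3, h4, h5⟩ := exists_test_function_approximation hfg
  have hf : eLpNorm f 2 volume ≠ ⊤ := (Lp.memLp f).2.ne
  -- Fatou needs only convergence almost everywhere, so `p` is arbitrary.
  refine (Lp.eLpNorm_lim_le_liminf_eLpNorm (fun n => (h1 n).continuous.aestronglyMeasurable) f
    h5).trans ?_
  have hlim : Tendsto (fun n : ℕ => C * eLpNorm f 2 volume ^ a *
      (eLpNorm g 2 volume + (K * (n + 1 : ℝ≥0)⁻¹ : ℝ≥0) * eLpNorm f 2 volume) ^ b) atTop
      (𝓝 (C * eLpNorm f 2 volume ^ a * eLpNorm g 2 volume ^ b)) := by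
    refine ENNReal.Tendsto.const_mul ?_ (Or.inr ?_)
    · refine (ENNReal.continuous_rpow_const.tendsto _).comp ?_
      have hK0 : Tendsto (fun n : ℕ => ((K * (n + 1 : ℝ≥0)⁻¹ : ℝ≥0) : ℝ≥0∞)) atTop (𝓝 0) := by
        have := ((tendsto_inv_atTop_nhds_zero_nat (𝕜 := ℝ≥0)).comp
          (tendsto_add_atTop_nat 1)).const_mul K
        rw [mul_zero] at this
        rw [← ENNReal.coe_zero, ENNReal.tendsto_coe]
        simpa using this
      have := (ENNReal.Tendsto.mul_const hK0 (Or.inr hf)).const_add (eLpNorm g 2 volume)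
      simpa using this
    · exact ENNReal.mul_ne_top ENNReal.coe_ne_top (ENNReal.rpow_ne_top_of_nonneg ha hf)
  rw [← hlim.liminf_eq]
  refine liminf_le_liminf (Eventually.of_forall fun n => (hC _ (h1 n) (h2 n)).trans ?_)
  gcongr
  · exact h3 n
  · exact h4 n

/-! ### Gagliardo–Nirenberg inequalities for test functions -/

/-- Agmon's inequality on the line. -/
lemma eLpNorm_top_le_of_dim_one {h : Space 1 → ℝ} (hh : ContDiff ℝ 1 h) (hc : HasCompactSupport h) :
    eLpNorm h ⊤ volume ≤ (2 : ℝ≥0) * eLpNorm h 2 volume ^ (1 / 2 : ℝ)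
      * eLpNorm (fderiv ℝ h) 2 volume ^ (1 / 2 : ℝ) := by
  let L : ℝ ≃ₗᵢ[ℝ] Space 1 := (OrthonormalBasis.singleton (Fin 1) ℝ).repr
  have hLm : MeasurePreserving L volume volume := L.measurePreserving
  set k : ℝ → ℝ := fun s => h (L s) with hk
  have hkc : ContDiff ℝ 1 k := hh.comp L.contDiff
  have hks : HasCompactSupport k := hc.comp_homeomorph L.toHomeomorph
  have hk2 : eLpNorm k 2 volume = eLpNorm h 2 volume :=
    eLpNorm_comp_measurePreserving hh.continuous.aestronglyMeasurable hLm
  have hkd : eLpNorm (deriv k) 2 volume ≤ eLpNorm (fderiv ℝ h) 2 volume := by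
    have h1 : eLpNorm (fun s => fderiv ℝ h (L s)) 2 volume = eLpNorm (fderiv ℝ h) 2 volume :=
      eLpNorm_comp_measurePreserving (hh.continuous_fderiv (by simp)).aestronglyMeasurable hLm
    rw [← h1]
    refine eLpNorm_mono fun s => ?_
    have h2 : HasFDerivAt k ((fderiv ℝ h (L s)).comp (L : ℝ →L[ℝ] Space 1)) s :=
      (hh.differentiable (by simp) (L s)).hasFDerivAt.comp s L.toContinuousLinearEquiv.hasFDerivAt
    rw [h2.hasDerivAt.deriv]
    refine ((fderiv ℝ h (L s)).le_opNorm _).trans ?_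
    have : ‖L 1‖ = 1 := by simp
    exact (mul_le_mul_of_nonneg_left this.le (norm_nonneg _)).trans_eq (mul_one _)
  have hsq : ∀ s, ‖k s‖ₑ ^ 2 ≤ 2 * (eLpNorm h 2 volume * eLpNorm (fderiv ℝ h) 2 volume) := by
    intro s
    -- The fundamental theorem of calculus for `k²`, whose derivative is `2 k k'`, followed by
    -- Cauchy–Schwarz.
    have h1 := HasCompactSupport.enorm_le_lintegral_Ici_deriv (f := fun s => k s * k s)
      (hkc.mul hkc) hks.mul_right s
    have h2 : ∀ y, ‖deriv (fun s => k s * k s) y‖ₑ = 2 * ‖(k • deriv k) y‖ₑ := by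
      intro y
      have hd := (hkc.differentiable (by simp) y).hasDerivAt
      rw [(hd.fun_mul hd).deriv]
      have : deriv k y * k y + k y * deriv k y = 2 * (k • deriv k) y := by
        simp only [Pi.smul_apply', smul_eq_mul]
        ring
      rw [this, enorm_mul]
      congr 1
      simp [enorm_eq_nnnorm]
    simp only [h2] at h1
    rw [pow_two, ← enorm_mul]
    refine h1.trans ((setLIntegral_le_lintegral _ _).trans ?_)
    rw [lintegral_const_mul' _ _ (by norm_num), ← eLpNorm_one_eq_lintegral_enorm]
    gcongr
    refine (eLpNorm_smul_le_mul_eLpNorm (p := 2) (q := 2)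
      (hkc.continuous_deriv (by simp)).aestronglyMeasurable
      hkc.continuous.aestronglyMeasurable).trans ?_
    rw [hk2]
    gcongr
  rw [eLpNorm_exponent_top]
  refine eLpNormEssSup_le_of_ae_enorm_bound (Eventually.of_forall fun x => ?_)
  have h1 := hsq (L.symm x)
  simp only [hk, LinearIsometryEquiv.apply_symm_apply] at h1
  rw [mul_assoc, ← ENNReal.mul_rpow_of_nonneg _ _ (by norm_num : (0 : ℝ) ≤ 1 / 2)]
  rw [← ENNReal.pow_le_pow_left_iff two_ne_zero, mul_pow]
  refine h1.trans ?_
  rw [← ENNReal.rpow_natCast (_ ^ _) 2, ← ENNReal.rpow_mul]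
  norm_num
  gcongr
  norm_num

/-- Ladyzhenskaya-type inequalities in the plane. -/
lemma eLpNorm_pow_le_of_dim_two (k : ℕ) : ∃ C : ℝ≥0, ∀ h : Space 2 → ℝ, ContDiff ℝ 1 h →
    HasCompactSupport h → eLpNorm (fun x => h x ^ (k + 1)) 2 volume
      ≤ C * eLpNorm h 2 volume * eLpNorm (fderiv ℝ h) 2 volume ^ k := by
  induction k with
  | zero => exact ⟨1, fun h _ _ => by simp⟩
  | succ k ih =>
    obtain ⟨C, hC⟩ := ih
    have hconj : NNReal.HolderConjugate (Module.finrank ℝ (Space 2)) 2 := by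
      rw [finrank_euclideanSpace_fin]
      exact_mod_cast NNReal.HolderConjugate.two_two
    refine ⟨eLpNormLESNormFDerivOneConst (volume : Measure (Space 2)) (2 : ℝ≥0) * ((k + 2 : ℕ) * C),
      fun h hh hc => ?_⟩
    -- The planar embedding `W^{1,1} ⊂ L²` applied to `h^(k+2)`: one more power of `h` costs one
    -- factor `‖∇h‖₂`.
    have h1 := eLpNorm_le_eLpNorm_fderiv_one (volume : Measure (Space 2))
      (u := fun x => h x ^ (k + 2)) (hh.pow (k + 2))
      (hc.comp_left (g := fun y : ℝ => y ^ (k + 2)) (by simp)) hconj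
    have h2 : eLpNorm (fderiv ℝ (fun x => h x ^ (k + 2))) 1 volume
        ≤ (k + 2 : ℕ) * (eLpNorm (fun x => h x ^ (k + 1)) 2 volume
          * eLpNorm (fderiv ℝ h) 2 volume) := by
      have h3 : fderiv ℝ (fun x => h x ^ (k + 2))
          = ((k + 2 : ℕ) : ℝ) • ((fun x => h x ^ (k + 1)) • fderiv ℝ h) := by
        funext x
        have := ((hh.differentiable (by simp) x).hasFDerivAt.pow (k + 2)).fderiv
        rw [this]
        simp [smul_smul]
      rw [h3]
      refine (eLpNorm_const_smul ((k + 2 : ℕ) : ℝ) ((fun x => h x ^ (k + 1)) • fderiv ℝ h) 1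
        volume).trans_le ?_
      refine mul_le_mul' (Real.enorm_natCast _).le ?_
      exact eLpNorm_smul_le_mul_eLpNorm (p := 2) (q := 2)
        (hh.continuous_fderiv (by simp)).aestronglyMeasurable
        (hh.continuous.pow _).aestronglyMeasurable
    calc eLpNorm (fun x => h x ^ (k + 1 + 1)) 2 volume
        ≤ eLpNormLESNormFDerivOneConst (volume : Measure (Space 2)) (2 : ℝ≥0)
          * ((k + 2 : ℕ) * ((C * eLpNorm h 2 volume * eLpNorm (fderiv ℝ h) 2 volume ^ k)
            * eLpNorm (fderiv ℝ h) 2 volume)) := by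
          refine h1.trans ?_
          gcongr
          refine h2.trans ?_
          gcongr
          exact hC h hh hc
      _ = _ := by
          push_cast
          ring

/-- The Gagliardo–Nirenberg inequality at one exponent `Q ≤ q`. -/
lemma exists_gagliardo_nirenberg {d : ℕ} {q : ℝ≥0∞}
    (hdq : (2 ≤ d ∧ (d : ℝ≥0∞) < q) ∨ (d = 1 ∧ 2 ≤ q)) :
    ∃ (Q : ℝ≥0) (P : ℝ≥0∞) (C : ℝ≥0), 0 < Q ∧ (Q : ℝ≥0∞) ≤ q ∧ (d : ℝ) / Q ≤ 1 ∧
      ENNReal.HolderTriple Q P 2 ∧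
      ∀ h : Space d → ℝ, ContDiff ℝ 1 h → HasCompactSupport h →
        eLpNorm h P volume ≤ C * eLpNorm h 2 volume ^ (1 - d / Q : ℝ)
          * eLpNorm (fderiv ℝ h) 2 volume ^ (d / Q : ℝ) := by
  rcases hdq with ⟨hd, hdq⟩ | ⟨rfl, hq⟩
  · rcases hd.eq_or_lt with rfl | hd
    -- For `d = 2` the exponents `Q = 2(k+2)/(k+1)` decrease to `2`, so the strict inequality `q >
    -- 2` leaves room for one. The partner is `P = 2(k+2)`.
    · obtain ⟨k, hk⟩ : ∃ k : ℕ, ((2 * (k + 2) / (k + 1) : ℝ≥0) : ℝ≥0∞) ≤ q := by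
        have hlim : Tendsto (fun k : ℕ => (2 * (k + 2) / (k + 1) : ℝ≥0)) atTop (𝓝 2) := by
          have h1 : Tendsto (fun k : ℕ => (2 + 2 * (1 / ((k : ℝ≥0) + 1)) : ℝ≥0)) atTop
              (𝓝 (2 + 2 * 0)) :=
            (tendsto_one_div_add_atTop_nhds_zero_nat.const_mul 2).const_add 2
          rw [mul_zero, add_zero] at h1
          refine h1.congr fun k => ?_
          field_simp
          ring
        have h2 := (ENNReal.tendsto_coe.2 hlim).eventually_lt_const (by exact_mod_cast hdq)
        obtain ⟨k, hk⟩ := h2.exists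
        exact ⟨k, hk.le⟩
      obtain ⟨C, hC⟩ := eLpNorm_pow_le_of_dim_two (k + 1)
      have hQ : (((2 : ℕ) : ℝ) / ((2 * (k + 2) / (k + 1) : ℝ≥0) : ℝ)) = (k + 1) / (k + 2) := by
        push_cast
        field_simp
      refine ⟨2 * (k + 2) / (k + 1), ((2 * (k + 2) : ℝ≥0) : ℝ≥0∞), C ^ (1 / (k + 2) : ℝ),
        by positivity, hk, ?_, ?_, ?_⟩
      · rw [hQ, div_le_one (by positivity)]
        linarith
      · constructor
        rw [← ENNReal.coe_inv (by positivity), ← ENNReal.coe_inv (by positivity),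
          ← ENNReal.coe_ofNat, ← ENNReal.coe_inv (by positivity), ← ENNReal.coe_add]
        congr 1
        field_simp
        ring
      · intro h hh hc
        rw [hQ]
        have h1 := hC h hh hc
        have h2 : eLpNorm (fun x => h x ^ (k + 1 + 1)) 2 volume
            = eLpNorm h ((2 * (k + 2) : ℝ≥0) : ℝ≥0∞) volume ^ (k + 2 : ℝ) := by
          have h3 := eLpNorm_norm_rpow (p := 2) (μ := volume) h
            (show (0 : ℝ) < ((k + 2 : ℕ) : ℝ) by positivity)
          have h4 : (2 : ℝ≥0∞) * ENNReal.ofReal ((k + 2 : ℕ) : ℝ)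
              = ((2 * (k + 2) : ℝ≥0) : ℝ≥0∞) := by
            rw [ENNReal.ofReal_natCast]
            push_cast
            rfl
          have h6 : ((k + 2 : ℕ) : ℝ) = (k : ℝ) + 2 := by push_cast; rfl
          rw [h4] at h3
          rw [← h6, ← h3, ← eLpNorm_norm]
          simp only [norm_pow, Real.rpow_natCast]
        rw [h2] at h1
        have h5 := ENNReal.rpow_le_rpow h1 (show (0 : ℝ) ≤ 1 / (k + 2) by positivity)
        rw [← ENNReal.rpow_mul, ENNReal.mul_rpow_of_nonneg _ _ (by positivity),
          ENNReal.mul_rpow_of_nonneg _ _ (by positivity), ← ENNReal.rpow_natCast,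
          ← ENNReal.rpow_mul] at h5
        have e1 : ((k : ℝ) + 2) * (1 / (k + 2)) = 1 := by field_simp
        have e2 : ((k + 1 : ℕ) : ℝ) * (1 / (k + 2)) = (k + 1) / (k + 2) := by
          push_cast
          field_simp
        have e3 : (1 : ℝ) - (k + 1) / (k + 2) = 1 / (k + 2) := by
          field_simp
          ring
        rw [e1, ENNReal.rpow_one, e2] at h5
        rw [e3, ENNReal.coe_rpow_of_nonneg _ (by positivity)]
        exact h5
    -- For `d ≥ 3`, `Q = d` and `P = 2d/(d-2)` is the Sobolev exponent, with no interpolation.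
    · obtain ⟨m, rfl⟩ : ∃ m, d = m + 1 + 2 := ⟨d - 3, by omega⟩
      have hne : ((m + 1 + 2 : ℕ) : ℝ) ≠ 0 := by positivity
      have hdiv : ((m + 1 + 2 : ℕ) : ℝ) / (((m + 1 + 2 : ℕ) : ℝ≥0) : ℝ) = 1 := by
        rw [NNReal.coe_natCast, div_self hne]
      refine ⟨(m + 1 + 2 : ℕ), ((2 * (m + 1 + 2) / (m + 1) : ℝ≥0) : ℝ≥0∞),
        eLpNormLESNormFDerivOfEqInnerConst (volume : Measure (Space (m + 1 + 2))) (2 : ℝ≥0),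
        by positivity, ?_, hdiv.le, ?_, ?_⟩
      · exact_mod_cast hdq.le
      · constructor
        rw [← ENNReal.coe_inv (by positivity), ← ENNReal.coe_inv (by positivity),
          ← ENNReal.coe_ofNat, ← ENNReal.coe_inv (by positivity), ← ENNReal.coe_add]
        congr 1
        push_cast
        field_simp
        ring
      · intro h hh hc
        have h1 := eLpNorm_le_eLpNorm_fderiv_of_eq_inner
          (volume : Measure (Space (m + 1 + 2))) hh hc
          (p := 2) (p' := (2 * (m + 1 + 2) / (m + 1) : ℝ≥0)) (by norm_num)
          (by rw [finrank_euclideanSpace_fin]; omega) (by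
            rw [finrank_euclideanSpace_fin]
            push_cast
            field_simp
            ring)
        rw [hdiv, sub_self, ENNReal.rpow_zero, ENNReal.rpow_one, mul_one]
        exact h1
  · refine ⟨2, ⊤, 2, by norm_num, hq, by norm_num, ⟨by simp⟩, fun h hh hc => ?_⟩
    have := eLpNorm_top_le_of_dim_one hh hc
    norm_num at this ⊢
    exact this

/-! ### The product of a Sobolev function with the drift -/

/-- Interpolation of a product between `L²` and `L^Q · L^P`. -/
lemma eLpNorm_smul_le_interpolate {α E : Type*} [MeasurableSpace α] {μ : Measure α}
    [NormedAddCommGroup E] [NormedSpace ℝ E] {f : α → ℝ} {b : α → E}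
    (hf : AEStronglyMeasurable f μ) (hb : AEStronglyMeasurable b μ) {Q q : ℝ≥0} {P : ℝ≥0∞}
    (hQ : 0 < Q) (hQq : Q ≤ q) [ENNReal.HolderTriple Q P 2] :
    eLpNorm (f • b) 2 μ ≤ eLpNorm b q μ * eLpNorm f P μ ^ (Q / q : ℝ)
      * eLpNorm f 2 μ ^ (1 - Q / q : ℝ) := by
  have hq : 0 < q := hQ.trans_le hQq
  have hQ' : (0 : ℝ) < Q := hQ
  have hq' : (0 : ℝ) < q := hq
  set m : ℝ := Q / q with hm
  have hm0 : 0 < m := by positivity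
  have hm1 : m ≤ 1 := (div_le_one hq').2 (by exact_mod_cast hQq)
  -- `|f b| = (B |f|)^m |f|^(1-m)`, and `B` is in `L^Q` when `b` is in `L^q`, because `Q/m = q`.
  set B : α → ℝ := fun x => ‖b x‖ ^ (1 / m) with hB
  have hBm : AEStronglyMeasurable B μ :=
    (hb.norm.aemeasurable.pow_const _).aestronglyMeasurable
  have h1 : eLpNorm (B • f) 2 μ ≤ eLpNorm b q μ ^ (1 / m) * eLpNorm f P μ := by
    refine (eLpNorm_smul_le_mul_eLpNorm (p := Q) (q := P) hf hBm).trans_eq ?_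
    rw [hB, eLpNorm_norm_rpow b (by positivity)]
    congr 3
    rw [← ENNReal.ofReal_coe_nnreal, ← ENNReal.ofReal_mul hQ'.le, ← ENNReal.ofReal_coe_nnreal]
    congr 1
    rw [hm]
    field_simp
  have h2 : eLpNorm (f • b) 2 μ ≤ eLpNorm (B • f) 2 μ ^ m * eLpNorm f 2 μ ^ (1 - m) := by
    rw [eLpNorm_eq_lintegral_rpow_enorm_toReal (by norm_num) (by norm_num),
      eLpNorm_eq_lintegral_rpow_enorm_toReal (by norm_num) (by norm_num),
      eLpNorm_eq_lintegral_rpow_enorm_toReal (by norm_num) (by norm_num)]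
    simp only [ENNReal.toReal_ofNat]
    rw [← ENNReal.rpow_mul, ← ENNReal.rpow_mul, mul_comm (1 / 2 : ℝ) m,
      mul_comm (1 / 2 : ℝ) (1 - m), ENNReal.rpow_mul, ENNReal.rpow_mul,
      ← ENNReal.mul_rpow_of_nonneg _ _ (by norm_num : (0 : ℝ) ≤ 1 / 2)]
    gcongr ?_ ^ _
    refine le_trans (le_of_eq ?_) (ENNReal.lintegral_mul_norm_pow_le
      ((hBm.smul hf).enorm.pow_const 2) (hf.enorm.pow_const 2) hm0.le (by linarith) (by ring))
    congr 1 with x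
    have e1 : ‖B x‖ₑ = ‖b x‖ₑ ^ (1 / m) := by
      rw [hB, Real.enorm_rpow_of_nonneg (norm_nonneg _) (by positivity), enorm_norm]
    simp only [Pi.smul_apply', smul_eq_mul, enorm_smul, enorm_mul, e1]
    rw [ENNReal.mul_rpow_of_nonneg _ _ (by norm_num : (0 : ℝ) ≤ 2),
      ENNReal.mul_rpow_of_nonneg _ _ (by norm_num : (0 : ℝ) ≤ 2),
      ENNReal.mul_rpow_of_nonneg _ _ hm0.le, ← ENNReal.rpow_mul, ← ENNReal.rpow_mul,
      ← ENNReal.rpow_mul, ← ENNReal.rpow_mul, mul_assoc,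
      ← ENNReal.rpow_add_of_nonneg _ _ (by positivity) (by nlinarith), mul_comm]
    congr 2
    · field_simp
    · ring
  refine h2.trans ?_
  calc eLpNorm (B • f) 2 μ ^ m * eLpNorm f 2 μ ^ (1 - m)
      ≤ (eLpNorm b q μ ^ (1 / m) * eLpNorm f P μ) ^ m * eLpNorm f 2 μ ^ (1 - m) := by gcongr
    _ = eLpNorm b q μ * eLpNorm f P μ ^ m * eLpNorm f 2 μ ^ (1 - m) := by
        rw [ENNReal.mul_rpow_of_nonneg _ _ hm0.le, ← ENNReal.rpow_mul, one_div,
          inv_mul_cancel₀ hm0.ne', ENNReal.rpow_one]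

/-- The product of a Sobolev function with an `L^q` field, by Gagliardo–Nirenberg. -/
lemma exists_eLpNorm_smul_le {d : ℕ} {q : ℝ≥0∞}
    (hdq : (2 ≤ d ∧ (d : ℝ≥0∞) < q) ∨ (d = 1 ∧ 2 ≤ q)) :
    ∃ C : ℝ≥0, ∀ (f : L2 d) (g : L2Vec d), IsWeakGradient f g → ∀ b : Space d → Space d,
      AEStronglyMeasurable b volume →
      eLpNorm (⇑f • b) 2 volume ≤ C * eLpNorm b q volume
        * (eLpNorm f 2 volume ^ (1 - ((d : ℝ≥0∞) / q).toReal)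
          * eLpNorm g 2 volume ^ ((d : ℝ≥0∞) / q).toReal) := by
  obtain ⟨Q, P, C, hQ, hQq, hdQ, hQP, hC⟩ := exists_gagliardo_nirenberg hdq
  induction q with
  -- Here `d/q = 0`, and Hölder alone suffices.
  | top =>
    refine ⟨1, fun f g _ b hb => ?_⟩
    have := eLpNorm_smul_le_mul_eLpNorm (p := 2) (q := ⊤) (r := 2) hb (Lp.aestronglyMeasurable f)
    simpa [mul_comm] using this
  | coe q =>
    have hQq' : Q ≤ q := by exact_mod_cast hQq
    have hq : 0 < q := hQ.trans_le hQq'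
    have hQ' : (0 : ℝ) < Q := hQ
    have hq' : (0 : ℝ) < q := hq
    have hm1 : (Q : ℝ) / q ≤ 1 := (div_le_one hq').2 (by exact_mod_cast hQq')
    have hθ : ((d : ℝ≥0∞) / q).toReal = d / q := by
      rw [ENNReal.toReal_div]
      simp
    refine ⟨C ^ (Q / q : ℝ), fun f g hfg b hb => ?_⟩
    rw [hθ]
    refine (eLpNorm_smul_le_interpolate (P := P) (Lp.aestronglyMeasurable f) hb hQ hQq').trans ?_
    have h1 := eLpNorm_le_of_forall_test_function (p := P) (by linarith) (by positivity) hC hfg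
    calc eLpNorm b q volume * eLpNorm f P volume ^ (Q / q : ℝ)
          * eLpNorm f 2 volume ^ (1 - Q / q : ℝ)
        ≤ eLpNorm b q volume * (C * eLpNorm f 2 volume ^ (1 - d / Q : ℝ)
          * eLpNorm g 2 volume ^ (d / Q : ℝ)) ^ (Q / q : ℝ)
          * eLpNorm f 2 volume ^ (1 - Q / q : ℝ) := by gcongr
      _ = C ^ (Q / q : ℝ) * eLpNorm b q volume * ((eLpNorm f 2 volume ^ ((1 - d / Q) * (Q / q) : ℝ)
          * eLpNorm f 2 volume ^ (1 - Q / q : ℝ))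
          * eLpNorm g 2 volume ^ (d / Q * (Q / q) : ℝ)) := by
          rw [ENNReal.mul_rpow_of_nonneg _ _ (by positivity),
            ENNReal.mul_rpow_of_nonneg _ _ (by positivity), ← ENNReal.rpow_mul,
            ← ENNReal.rpow_mul]
          ring
      _ = _ := by
          rw [← ENNReal.rpow_add_of_nonneg _ _
            (mul_nonneg (by linarith) (by positivity)) (by linarith),
            ENNReal.coe_rpow_of_nonneg _ (by positivity),
            show (1 - d / Q) * (Q / q) + (1 - Q / q) = (1 - d / q : ℝ) by
              field_simp
              ring,
            show d / Q * (Q / q) = (d / q : ℝ) by field_simp]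

/-! ### Measurability in time and separability of `H¹` -/

/-- `L^q` norms of the sections of a measurable function are measurable. -/
lemma aemeasurable_eLpNorm_section {α β E : Type*} [MeasurableSpace α] [MeasurableSpace β]
    {μ : Measure α} {ν : Measure β} [SFinite ν] [NormedAddCommGroup E] {q : ℝ≥0∞} (hq : q ≠ 0)
    {b : α → β → E} (hb : AEStronglyMeasurable (fun z : α × β => b z.1 z.2) (μ.prod ν)) :
    AEMeasurable (fun t => eLpNorm (b t) q ν) μ := by
  induction q with
  | top =>
    obtain ⟨b', hb', hbb'⟩ := hb
    refine ⟨fun t => eLpNorm (fun x => b' (t, x)) ⊤ ν, ?_, ?_⟩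
    -- The essential supremum is at most `a` exactly when the slice of `{a < ‖b'‖}` is null, and
    -- measures of slices are measurable.
    · refine measurable_of_Iic fun a => ?_
      have hs : MeasurableSet {z : α × β | a < ‖b' z‖ₑ} :=
        measurableSet_lt measurable_const hb'.enorm
      have h1 := measurable_measure_prodMk_left (ν := ν) hs
      have h2 : (fun t => eLpNorm (fun x => b' (t, x)) ⊤ ν) ⁻¹' Iic a
          = (fun t => ν (Prod.mk t ⁻¹' {z : α × β | a < ‖b' z‖ₑ})) ⁻¹' {0} := by
        ext t
        simp only [mem_preimage, mem_Iic, mem_singleton_iff, eLpNorm_exponent_top]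
        have h3 : ν (Prod.mk t ⁻¹' {z : α × β | a < ‖b' z‖ₑ}) = 0
            ↔ ∀ᵐ x ∂ν, ‖b' (t, x)‖ₑ ≤ a := by
          rw [ae_iff]
          simp only [not_le]
          rfl
        rw [h3]
        constructor
        · intro h
          filter_upwards [enorm_ae_le_eLpNormEssSup (fun x => b' (t, x)) ν] with x hx
          exact hx.trans h
        · exact eLpNormEssSup_le_of_ae_enorm_bound
      rw [h2]
      exact h1 (measurableSet_singleton 0)
    · filter_upwards [Measure.ae_ae_of_ae_prod hbb'] with t ht
      exact eLpNorm_congr_ae ht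
  | coe q =>
    simp only [eLpNorm_eq_lintegral_rpow_enorm_toReal hq ENNReal.coe_ne_top]
    exact ((hb.enorm.pow_const _).lintegral_prod_right').pow_const _

instance (d : ℕ) : SecondCountableTopology (L2 d) := by
  have : Fact ((2 : ℝ≥0∞) ≠ ⊤) := ⟨by simp⟩
  exact Lp.SecondCountableTopology

instance (d : ℕ) : SecondCountableTopology (L2Vec d) := by
  have : Fact ((2 : ℝ≥0∞) ≠ ⊤) := ⟨by simp⟩
  exact Lp.SecondCountableTopology

/-- The embedding of `H¹` into `L²`. -/
def H1.toL2L (d : ℕ) : H1 d →L[ℝ] L2 d :=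
  (WithLp.fstL 2 ℝ (L2 d) (L2Vec d)).comp (H1 d).subtypeL

/-- The weak gradient as a continuous linear map. -/
def H1.gradL (d : ℕ) : H1 d →L[ℝ] L2Vec d :=
  (WithLp.sndL 2 ℝ (L2 d) (L2Vec d)).comp (H1 d).subtypeL

/-! ### The energy inequality -/

lemma AdmissibleExponents.two_div_add_le {d : ℕ} {r q : ℝ≥0∞} (h : AdmissibleExponents d r q) :
    2 ≤ r.toReal ∧ r ≠ ⊤ ∧ 2 / r.toReal + ((d : ℝ≥0∞) / q).toReal ≤ 1 := by
  have hr : 2 ≤ r ∧ r ≠ ⊤ := by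
    rcases h.2 with ⟨_, h1, h2, _⟩ | ⟨_, h1, h2, _⟩
    · exact ⟨h1, h2.ne⟩
    · exact ⟨h1, (h2.trans_lt (by simp)).ne⟩
  refine ⟨?_, hr.2, ?_⟩
  · simpa using ENNReal.toReal_mono hr.2 hr.1
  · have h1 := ENNReal.toReal_mono ENNReal.one_ne_top h.1
    have h2 : (2 / r + (d : ℝ≥0∞) / q) ≠ ⊤ := (h.1.trans_lt ENNReal.one_lt_top).ne
    rw [ENNReal.add_ne_top] at h2
    rw [ENNReal.toReal_add h2.1 h2.2, ENNReal.toReal_div 2 r] at h1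
    simpa using h1

lemma AdmissibleExponents.exponent_condition {d : ℕ} {r q : ℝ≥0∞}
    (h : AdmissibleExponents d r q) : (2 ≤ d ∧ (d : ℝ≥0∞) < q) ∨ (d = 1 ∧ 2 ≤ q) := by
  rcases h.2 with ⟨h0, _, _, h1⟩ | ⟨h0, _, _, h1⟩
  · exact Or.inl ⟨h0, h1⟩
  · exact Or.inr ⟨h0, h1⟩

/-- Young's inequality absorbing the gradient. -/
lemma mul_rpow_mul_rpow_le {β X Y θ ρ : ℝ} (hβ : 0 ≤ β) (hX : 0 ≤ X) (hY : 0 ≤ Y) (hθ : 0 ≤ θ)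
    (hρ : 2 ≤ ρ) (h : 2 / ρ + θ ≤ 1) {C : ℝ} (hC : 0 ≤ C) :
    C * β * (X ^ (1 - θ) * Y ^ θ) * Y
      ≤ Y ^ 2 + C ^ (2 / (1 - θ)) * (1 + β ^ ρ) * X ^ 2 := by
  have hρ0 : 0 < ρ := by linarith
  have h2ρ : 0 < 2 / ρ := by positivity
  have hθ1 : 0 < 1 - θ := by linarith
  have hYθ : Y ^ θ * Y = (Y ^ 2) ^ ((1 + θ) / 2) := by
    rw [← Real.rpow_natCast Y 2, ← Real.rpow_mul hY]
    nth_rw 2 [← Real.rpow_one Y]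
    rw [← Real.rpow_add_of_nonneg hY hθ zero_le_one]
    congr 1
    push_cast
    ring
  have hXC : C * β * X ^ (1 - θ) = ((C * β) ^ (2 / (1 - θ)) * X ^ 2) ^ ((1 - θ) / 2) := by
    rw [Real.mul_rpow (by positivity) (by positivity), ← Real.rpow_mul (by positivity),
      ← Real.rpow_natCast X 2, ← Real.rpow_mul hX]
    have e1 : 2 / (1 - θ) * ((1 - θ) / 2) = 1 := by field_simp
    have e2 : ((2 : ℕ) : ℝ) * ((1 - θ) / 2) = 1 - θ := by
      push_cast
      ring
    rw [e1, e2, Real.rpow_one]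
  have hyoung := Real.geom_mean_le_arith_mean2_weighted (w₁ := (1 + θ) / 2) (w₂ := (1 - θ) / 2)
    (p₁ := Y ^ 2) (p₂ := (C * β) ^ (2 / (1 - θ)) * X ^ 2) (by linarith) (by linarith)
    (by positivity) (by positivity) (by ring)
  -- This is the scaling condition `2/ρ + θ ≤ 1` rearranged.
  have hs : 2 / (1 - θ) ≤ ρ := by
    rw [div_le_iff₀ hθ1]
    have : 2 / ρ * ρ ≤ (1 - θ) * ρ := by gcongr; linarith
    rw [div_mul_cancel₀ _ hρ0.ne'] at this
    linarith
  -- The summand `1` covers `β ≤ 1`, where raising the exponent decreases the power.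
  have hβs : β ^ (2 / (1 - θ)) ≤ 1 + β ^ ρ := by
    rcases le_total β 1 with h1 | h1
    · have := Real.rpow_le_one hβ h1 (show 0 ≤ 2 / (1 - θ) by positivity)
      have := Real.rpow_nonneg hβ ρ
      linarith
    · have := Real.rpow_le_rpow_of_exponent_le h1 hs
      linarith
  have hA : (C * β) ^ (2 / (1 - θ)) * X ^ 2 ≤ C ^ (2 / (1 - θ)) * (1 + β ^ ρ) * X ^ 2 := by
    rw [Real.mul_rpow hC hβ]
    gcongr
  have hA0 : 0 ≤ (C * β) ^ (2 / (1 - θ)) * X ^ 2 := by positivity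
  calc C * β * (X ^ (1 - θ) * Y ^ θ) * Y
      = (Y ^ 2) ^ ((1 + θ) / 2) * ((C * β) ^ (2 / (1 - θ)) * X ^ 2) ^ ((1 - θ) / 2) := by
        rw [← hYθ, ← hXC]
        ring
    _ ≤ (1 + θ) / 2 * Y ^ 2 + (1 - θ) / 2 * ((C * β) ^ (2 / (1 - θ)) * X ^ 2) := hyoung
    _ ≤ Y ^ 2 + (C * β) ^ (2 / (1 - θ)) * X ^ 2 := by
        have h1 : (1 + θ) / 2 ≤ 1 := by linarith
        have h2 : (1 - θ) / 2 ≤ 1 := by linarith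
        have h3 := mul_le_mul_of_nonneg_right h1 (sq_nonneg Y)
        have h4 := mul_le_mul_of_nonneg_right h2 hA0
        linarith
    _ ≤ _ := by linarith

/-- The weak formulation, valid at a fixed time, gives the energy inequality. -/
lemma energy_inequality_at_time {d : ℕ} {q : ℝ≥0∞} {ρ : ℝ} (hρ : 2 ≤ ρ)
    (hρq : 2 / ρ + ((d : ℝ≥0∞) / q).toReal ≤ 1) {C : ℝ≥0}
    (hC : ∀ (f : L2 d) (g : L2Vec d), IsWeakGradient f g → ∀ b : Space d → Space d,
      AEStronglyMeasurable b volume →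
      eLpNorm (⇑f • b) 2 volume ≤ C * eLpNorm b q volume
        * (eLpNorm f 2 volume ^ (1 - ((d : ℝ≥0∞) / q).toReal)
          * eLpNorm g 2 volume ^ ((d : ℝ≥0∞) / q).toReal))
    {b : Space d → Space d} (hb : AEStronglyMeasurable b volume) (hbq : eLpNorm b q volume ≠ ⊤)
    {u : H1 d} {w : Hneg1 d} {S : Set (H1 d)} (hS : Dense S)
    (hw : ∀ v ∈ S, w v + ∫ x, inner ℝ (H1.grad u x) (H1.grad v x)
      = ∫ x, H1.toL2 u x * inner ℝ (b x) (H1.grad v x)) :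
    2 * w u ≤ 2 * (C : ℝ) ^ (2 / (1 - ((d : ℝ≥0∞) / q).toReal))
      * (1 + (eLpNorm b q volume).toReal ^ ρ) * ‖H1.toL2 u‖ ^ 2 := by
  set θ := ((d : ℝ≥0∞) / q).toReal with hθ
  have hθ0 : 0 ≤ θ := ENNReal.toReal_nonneg
  have hθ1 : 0 ≤ 1 - θ := by
    have : 0 < 2 / ρ := by positivity
    linarith
  have hbound := hC (H1.toL2 u) (H1.grad u) u.2 b hb
  have htop : (C : ℝ≥0∞) * eLpNorm b q volume
      * (eLpNorm (H1.toL2 u) 2 volume ^ (1 - θ) * eLpNorm (H1.grad u) 2 volume ^ θ) ≠ ⊤ :=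
    ENNReal.mul_ne_top (ENNReal.mul_ne_top ENNReal.coe_ne_top hbq)
      (ENNReal.mul_ne_top (ENNReal.rpow_ne_top_of_nonneg hθ1 (Lp.eLpNorm_ne_top _))
        (ENNReal.rpow_ne_top_of_nonneg hθ0 (Lp.eLpNorm_ne_top _)))
  have hF : MemLp (⇑(H1.toL2 u) • b) 2 volume :=
    ⟨(Lp.aestronglyMeasurable _).smul hb, hbound.trans_lt htop.lt_top⟩
  have hFn : ‖hF.toLp‖ ≤ C * (eLpNorm b q volume).toReal
      * (‖H1.toL2 u‖ ^ (1 - θ) * ‖H1.grad u‖ ^ θ) := by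
    rw [Lp.norm_toLp, Lp.norm_def, Lp.norm_def]
    have := ENNReal.toReal_mono htop hbound
    simpa [ENNReal.toReal_mul, ← ENNReal.toReal_rpow] using this
  -- Since `u b ∈ L²`, both sides are continuous in `v ∈ H¹`, so the identity passes from `S` to all
  -- `v`, in particular to `v = u`.
  have hext : ∀ v : H1 d, w v + inner ℝ (H1.gradL d u) (H1.gradL d v)
      = inner ℝ hF.toLp (H1.gradL d v) := by
    refine fun v => congrFun (Continuous.ext_on hS (f := fun v => w v
      + inner ℝ (H1.gradL d u) (H1.gradL d v)) (g := fun v => inner ℝ hF.toLp (H1.gradL d v))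
      (by fun_prop) (by fun_prop) fun v hv => ?_) v
    change w v + inner ℝ (H1.gradL d u) (H1.gradL d v) = inner ℝ hF.toLp (H1.gradL d v)
    rw [L2.inner_def, L2.inner_def]
    refine (hw v hv).trans (integral_congr_ae ?_)
    filter_upwards [hF.coeFn_toLp] with x hx
    rw [hx, Pi.smul_apply', real_inner_smul_left]
    rfl
  have hu := hext u
  rw [real_inner_self_eq_norm_sq] at hu
  have hcs : inner ℝ hF.toLp (H1.gradL d u) ≤ ‖hF.toLp‖ * ‖H1.grad u‖ := real_inner_le_norm _ _
  have hy := mul_rpow_mul_rpow_le (β := (eLpNorm b q volume).toReal) (X := ‖H1.toL2 u‖)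
    (Y := ‖H1.grad u‖) ENNReal.toReal_nonneg (norm_nonneg _) (norm_nonneg _) hθ0 hρ hρq
    C.coe_nonneg
  have hm := mul_le_mul_of_nonneg_right hFn (norm_nonneg (H1.grad u))
  have hgrad : ‖H1.gradL d u‖ = ‖H1.grad u‖ := rfl
  rw [hgrad] at hu
  linarith

end AdvectionDiffusion

end

/-! ### The theorem -/

open AdvectionDiffusion in
theorem theorem2p1 (d : ℕ) (r q : ℝ≥0∞) (hrq : AdmissibleExponents d r q) (M : ℝ≥0) :
    ∃ C : ℝ, ∀ b : ℝ → Space d → Space d,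
      AEStronglyMeasurable (fun z : ℝ × Space d => b z.1 z.2) (timeMeasure.prod volume) →
      mixedNorm r q b ≤ M →
      ∀ u : ℝ → H1 d, IsParabolicSolution b u →
        ∃ U : ℝ → L2 d, ContinuousOn U (Icc 0 1) ∧ (∀ᵐ t ∂timeMeasure, U t = H1.toL2 (u t)) ∧
          ∀ t ∈ Icc (0 : ℝ) 1, ‖U t‖ ≤ C * ‖U 0‖ := by
  obtain ⟨hr2, hrtop, hrq'⟩ := hrq.two_div_add_le
  have hr0 : r ≠ 0 := by
    rintro rfl
    norm_num at hr2
  have hq0 : q ≠ 0 := by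
    rcases hrq.exponent_condition with ⟨_, h⟩ | ⟨_, h⟩
    · exact (bot_lt_of_lt h).ne'
    · rintro rfl
      norm_num at h
  obtain ⟨C, hC⟩ := exists_eLpNorm_smul_le hrq.exponent_condition
  set A : ℝ := 2 * (C : ℝ) ^ (2 / (1 - ((d : ℝ≥0∞) / q).toReal)) with hA
  have hA0 : 0 ≤ A := by positivity
  -- `A (1 + M^r)` bounds `∫ κ`, so `n` half-units suffice in Grönwall. This gives `2^n` for `‖U‖²`,
  -- hence the square root in the constant.
  obtain ⟨n, hn⟩ := exists_nat_ge (2 * (A * (1 + (M : ℝ) ^ r.toReal)))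
  refine ⟨Real.sqrt (2 ^ n), fun b hb hbM u hu => ?_⟩
  obtain ⟨hu2, w, hw2, huw, heq⟩ := hu
  obtain ⟨U, hUc, hUu, henergy⟩ := exists_continuous_representative (H1.toL2L d) hu2 hw2 huw
  refine ⟨U, hUc, hUu, ?_⟩
  set β : ℝ → ℝ≥0∞ := fun t => eLpNorm (b t) q volume with hβ
  have hβm : AEMeasurable β timeMeasure := aemeasurable_eLpNorm_section hq0 hb
  have hβM : ∫⁻ t, β t ^ r.toReal ∂timeMeasure ≤ (M : ℝ≥0∞) ^ r.toReal := by
    have h1 := ENNReal.rpow_le_rpow hbM (show 0 ≤ r.toReal by linarith)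
    rw [mixedNorm, eLpNorm_eq_lintegral_rpow_enorm_toReal hr0 hrtop, ← ENNReal.rpow_mul,
      one_div, inv_mul_cancel₀ (by linarith), ENNReal.rpow_one] at h1
    exact h1
  have hMtop : (M : ℝ≥0∞) ^ r.toReal ≠ ⊤ :=
    ENNReal.rpow_ne_top_of_nonneg (by linarith) ENNReal.coe_ne_top
  have hβi : ∫⁻ t, β t ^ r.toReal ∂timeMeasure ≠ ⊤ := (hβM.trans_lt hMtop.lt_top).ne
  have hβfin : ∀ᵐ t ∂timeMeasure, β t ≠ ⊤ := by
    filter_upwards [ae_lt_top' (hβm.pow_const _) hβi] with t ht hbt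
    rw [hbt, ENNReal.top_rpow_of_pos (by linarith)] at ht
    exact lt_irrefl _ ht
  have hβint : Integrable (fun t => (β t).toReal ^ r.toReal) timeMeasure := by
    simp only [ENNReal.toReal_rpow]
    exact integrable_toReal_of_lintegral_ne_top (hβm.pow_const _) hβi
  set κ : ℝ → ℝ := fun t => A * (1 + (β t).toReal ^ r.toReal) with hκ
  have hκ0 : ∀ t, 0 ≤ κ t := fun t => by positivity
  have hκi : Integrable κ timeMeasure := ((integrable_const 1).add hβint).const_mul A
  have hκint : ∫ t in (0 : ℝ)..1, κ t ≤ n / 2 := by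
    rw [← integral_timeMeasure_eq_intervalIntegral, hκ, integral_const_mul,
      integral_add (integrable_const 1) hβint]
    have h1 : ∫ t, (β t).toReal ^ r.toReal ∂timeMeasure ≤ (M : ℝ) ^ r.toReal := by
      simp only [ENNReal.toReal_rpow]
      rw [integral_toReal (hβm.pow_const _) (ae_lt_top' (hβm.pow_const _) hβi)]
      have := ENNReal.toReal_mono hMtop hβM
      rwa [← ENNReal.toReal_rpow M, ENNReal.coe_toReal] at this
    have h2 : ∫ _ : ℝ, (1 : ℝ) ∂timeMeasure = 1 := by simp
    rw [h2]
    have h3 := mul_le_mul_of_nonneg_left h1 hA0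
    linarith
  have hpoint : ∀ᵐ t ∂timeMeasure, 2 * w t (u t) ≤ κ t * ‖U t‖ ^ 2 := by
    have hv : ∀ᵐ t ∂timeMeasure, ∀ v ∈ range (TopologicalSpace.denseSeq (H1 d)),
        w t v + ∫ x, inner ℝ (H1.grad (u t) x) (H1.grad v x)
          = ∫ x, H1.toL2 (u t) x * inner ℝ (b t x) (H1.grad v x) := by
      filter_upwards [ae_all_iff.2 fun n => heq (TopologicalSpace.denseSeq (H1 d) n)] with t ht
      rintro _ ⟨n, rfl⟩
      exact ht n
    filter_upwards [hv, hβfin, hb.prodMk_left, hUu] with t h1 h2 h3 h4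
    have := energy_inequality_at_time hr2 hrq' hC h3 h2
      (TopologicalSpace.denseRange_denseSeq (H1 d)) h1
    rw [h4]
    exact this
  have hwu : Integrable (fun t => w t (u t)) timeMeasure := integrable_dual_apply hw2 hu2
  have hgron := le_two_pow_mul_of_sub_le_integral (F := fun t => ‖U t‖ ^ 2) (hUc.norm.pow 2)
    (fun t _ => by positivity) hκi hκ0 (fun s hs t ht hst => by
      rw [henergy s hs t ht, ← intervalIntegral.integral_const_mul]
      refine intervalIntegral.integral_mono_ae_restrict hst
        ((intervalIntegrable_of_mem_Icc hwu hs ht).const_mul 2)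
        ((intervalIntegrable_of_mem_Icc hκi hs ht).mul_continuousOn
          ((hUc.norm.pow 2).mono (ordConnected_Icc.uIcc_subset hs ht))) ?_
      exact ae_restrict_of_ae_restrict_of_subset (Icc_subset_Icc hs.1 ht.2) hpoint) n
  intro t ht
  have hKt : ∫ x in (0 : ℝ)..t, κ x ≤ n / 2 :=
    (intervalIntegral.integral_mono_interval le_rfl ht.1 ht.2 (Eventually.of_forall hκ0)
      (intervalIntegrable_of_integrable_timeMeasure hκi)).trans hκint
  have h1 := hgron t ht hKt
  refine le_of_sq_le_sq ?_ (by positivity)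
  rw [mul_pow, Real.sq_sqrt (by positivity)]
  exact h1
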